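/- Let $n,r$ be positive integers and let $W$ be the Weyl group of type $B_r$, with simple reflections $S=\{s_0,s_1,\dots,s_{r-1}\}$, where $s_1,\dots,s_{r-1}$ generate the symmetric group $\mathfrak S_r$; let $\ell$ be the length function with respect to $S$, and put $t_1=s_0$, $t_i=s_{i-1}t_{i-1}s_{i-1}$ for $2\le i\le r$. Let $R$ be a commutative ring, $q_0,q\in R$ units, and let $H'$ be the Hecke algebra of $W$ over $R$, with basis $(T_w)_{w\in W}$ and, for $s\in S$, $T_sT_w=T_{sw}$ if $\ell(sw)>\ell(w)$ and $T_sT_w=(q_s-1)T_w+q_sT_{sw}$ otherwise, where $q_{s_0}=q_0$ and $q_{s_i}=q$ for $i\ge1$. For $0\le a\le r$ put $$\pi_a=\prod_{i=1}^a(q^{i-1}+T_{t_i}),\qquad \pi_a^-=\prod_{i=1}^a(q_0q^{i-1}-T_{t_i}).$$ A bicomposition of $r$ is a pair $\lambda=(\lambda^{(1)},\lambda^{(2)})$ of compositions, zero parts allowed, with $\max(n,r)$ and $n$ parts respectively, whose sizes add up to $r$. Put $a=|\lambda^{(1)}|$, let $\bar\lambda$ be the juxtaposition of $\lambda^{(1)}$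 and $\lambda^{(2)}$, let $\mathfrak S_{\bar\lambda}\le\mathfrak S_r$ be its Young subgroup, and put $W_\lambda=\langle t_1,\dots,t_a\rangle\,\mathfrak S_{\bar\lambda}$, $$x_\lambda=\pi_a\sum_{w\in\mathfrak S_{\bar\lambda}}T_w,\qquad y_\lambda=\pi_a^-\sum_{w\in\mathfrak S_{\bar\lambda}}(-q)^{-\ell(w)}T_w.$$ Let $\mathcal D_\lambda$ be the set of the elements $d\in W$ that are the unique element of minimal length in the coset $W_\lambda d$, and for bicompositions $\lambda,\mu$ let $\mathcal D^0_{\lambda,\mu}$ be the set of distinguished double coset representatives with the trivial intersection property, that is, of those $d\in\mathcal D_\lambda\cap\mathcal D_\mu^{-1}$ with $d^{-1}W_\lambda d\cap W_\mu=\{1\}$. Assume that $q_0+1$ is not a zero divisor in $R$. Then for all $0\le a,b\le r$ $$\pi_aH'\cap H'\pi_b^-=\pi_aH'\pi_b^-,$$ and this is $0$ if $a+b>r$. If in addition $q+1$ is not a zero divisor in $R$, then for all bicompositions $\lambda,\mu$ of $r$ $$x_\lambda H'\cap H'y_\mu=x_\lambda H'y_\mu,$$ and this intersection is a free $R$-module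 with basis $(x_\lambda T_wy_\mu)_{w\in\mathcal D^0_{\lambda,\mu}}$. Likewise $y_\lambda H'\cap H'x_\mu=y_\lambda H'x_\mu$, and this is a free $R$-module with basis $(y_\lambda T_wx_\mu)_{w\in\mathcal D^0_{\lambda,\mu}}$. -/

import Mathlib

open scoped Classical

noncomputable section

namespace HeckeB

/-! ### The Weyl group of type `B_r`

`W = C ⋊ 𝔖_r` with `C = {±1}^r` (signed permutations of `r` letters).  The letters are indexed by
`Fin r`, so the letter `i + 1` of the usual numbering is the element of `Fin r` with value `i`. -/

/-- The Weyl group of type `B_r`: the group of signed permutations of `r` letters. -/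
abbrev W (r : ℕ) : Type := (Fin r → ℤˣ) ⋊[mulAutArrow] (Equiv.Perm (Fin r))

instance (r : ℕ) : Fintype (W r) := Fintype.ofEquiv _ SemidirectProduct.equivProd.symm

/-- The simple reflections: `s 0` changes the sign of the first letter, and `s i`, for
`1 ≤ i ≤ r - 1`, is the transposition of the `i`-th and the `(i+1)`-st letter. -/
def s {r : ℕ} (i : Fin r) : W r :=
  if i.val = 0 then ⟨Pi.mulSingle i (-1), 1⟩
  else ⟨1, Equiv.swap ⟨i.val - 1, lt_of_le_of_lt (Nat.sub_le _ _) i.isLt⟩ i⟩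

/-- `tAux k` is the element `t_{k+1}`: `t_1 = s_0` and `t_{k+1} = s_k t_k s_k`. -/
def tAux {r : ℕ} : (k : ℕ) → k < r → W r
  | 0, h => s ⟨0, h⟩
  | k + 1, h => s ⟨k + 1, h⟩ * tAux k (Nat.lt_of_succ_lt h) * s ⟨k + 1, h⟩

/-- The element `t_{i+1}` (`0 ≤ i < r`), which changes the sign of the `(i+1)`-st letter. -/
def t {r : ℕ} (i : Fin r) : W r := tAux i.val i.isLt

/-- The word `l` in the simple reflections represents `w`. -/
def IsWord {r : ℕ} (w : W r) (l : List (Fin r)) : Prop := (l.map s).prod = w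

/-- The length of `w` with respect to `S = {s_0, …, s_{r-1}}` (a generating set of `W r`). -/
def length {r : ℕ} (w : W r) : ℕ := sInf {k | ∃ l : List (Fin r), IsWord w l ∧ l.length = k}

/-- A reduced expression of `w` (one of shortest length among the words that represent `w`). -/
def reducedWord {r : ℕ} (w : W r) : List (Fin r) :=
  Classical.epsilon fun l => IsWord w l ∧ l.length = length w

/-! ### The two-parameter Hecke algebra of type `B_r` -/

section Hecke

variable {R : Type*} [CommRing R] {r : ℕ} (q₀ q : Rˣ)

/-- The parameter attached to a simple reflection: `q₀` for `s_0` and `q` for the others. -/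
def param (i : Fin r) : R := if i.val = 0 then (q₀ : R) else (q : R)

/-- Left multiplication by `T_{s_i}` on the free `R`-module with basis `W`, the basis element
`Pi.single w 1` standing for `T_w`:  `T_s T_w = T_{sw}` if `ℓ(sw) > ℓ(w)`, and
`T_s T_w = (q_s - 1) T_w + q_s T_{sw}` otherwise. -/
def leftMul (i : Fin r) : Module.End R (W r → R) :=
  (Pi.basisFun R (W r)).constr R fun w =>
    if length w < length (s i * w) then Pi.single (s i * w) 1
    else (param q₀ q i - 1) • Pi.single w 1 + param q₀ q i • Pi.single (s i * w) 1

/-- The Hecke algebra `H'` of type `B_r` over `R` with parameters `q₀` and `q`, given by its left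
regular representation (which is faithful) on the free module with basis `T_w`, `w ∈ W`: the
algebra of operators generated by the left multiplications by the `T_{s_i}`.  Evaluation at the
basis element of `1 ∈ W` identifies it with this free module. -/
abbrev Hecke (R : Type*) [CommRing R] (r : ℕ) (q₀ q : Rˣ) :
    Subalgebra R (Module.End R (W r → R)) :=
  Algebra.adjoin R (Set.range (leftMul q₀ q))

/-- The generator `T_{s_i}` of the Hecke algebra. -/
def Tgen (i : Fin r) : Hecke R r q₀ q :=
  ⟨leftMul q₀ q i, Algebra.subset_adjoin (Set.mem_range_self i)⟩

/-- The element `T_w = T_{s_{i_1}} ⋯ T_{s_{i_m}}`, where `s_{i_1} ⋯ s_{i_m}` is a reduced expression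
of `w`. -/
def T (w : W r) : Hecke R r q₀ q := ((reducedWord w).map (Tgen q₀ q)).prod

/-- `π_a = ∏_{i=1}^a (q^{i-1} + T_{t_i})` for `0 ≤ a ≤ r`. -/
def piPlus (a : ℕ) : Hecke R r q₀ q :=
  (((List.finRange r).take a).map fun i =>
    algebraMap R (Hecke R r q₀ q) ((q : R) ^ i.val) + T q₀ q (t i)).prod

/-- `π_a⁻ = ∏_{i=1}^a (q₀ q^{i-1} - T_{t_i})` for `0 ≤ a ≤ r`. -/
def piMinus (a : ℕ) : Hecke R r q₀ q :=
  (((List.finRange r).take a).map fun i =>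
    algebraMap R (Hecke R r q₀ q) ((q₀ : R) * (q : R) ^ i.val) - T q₀ q (t i)).prod

end Hecke

/-! ### Bicompositions and quasi-parabolic subgroups -/

/-- The set `Π₂(n, r)` of bicompositions of `r`: pairs of compositions, with `max n r` and `n`
parts respectively (zero parts are allowed), of total size `r`. -/
structure Bicomposition (n r : ℕ) where
  fst : Fin (max n r) → ℕ
  snd : Fin n → ℕ
  sum_eq : ∑ i, fst i + ∑ i, snd i = r

namespace Bicomposition

variable {n r : ℕ} (lam mu : Bicomposition n r)

/-- The size `|λ⁽¹⁾|` of the first component. -/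
def size₁ : ℕ := ∑ i, lam.fst i

/-- The composition `λ̄` of `r` obtained from `λ` by juxtaposition. -/
def bar : Fin (max n r + n) → ℕ := Fin.append lam.fst lam.snd

/-- The partial sums `λ̄_1 + ⋯ + λ̄_k` of `λ̄`. -/
def partialSums : Set ℕ :=
  {m | ∃ k : ℕ, m = ∑ j ∈ Finset.univ.filter (fun j : Fin (max n r + n) => j.val < k), lam.bar j}

/-- The Young subgroup `W̄_λ = 𝔖_{λ̄}`, generated by the `s_i`, `1 ≤ i ≤ r - 1`, for which the
letters `i` and `i + 1` lie in the same block of `λ̄`. -/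
def young : Subgroup (W r) :=
  Subgroup.closure {w | ∃ i : Fin r, i.val ≠ 0 ∧ i.val ∉ lam.partialSums ∧ w = s i}

/-- `C_λ = ⟨t_1, …, t_a⟩`, where `a = |λ⁽¹⁾|`. -/
def signs : Subgroup (W r) :=
  Subgroup.closure {w | ∃ i : Fin r, i.val < lam.size₁ ∧ w = t i}

/-- The quasi-parabolic subgroup `W_λ = C_λ 𝔖_{λ̄}`. -/
def quasiParabolic : Subgroup (W r) := lam.signs ⊔ lam.young

/-- `𝒟_λ`: the distinguished right `W_λ`-coset representatives, that is, the elements `d` that are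
the unique element of minimal length in `W_λ d`. -/
def dist : Set (W r) :=
  {d | ∀ g ∈ lam.quasiParabolic, g ≠ 1 → length d < length (g * d)}

/-- `𝒟⁰_{λ,μ}`: the elements `d` of `𝒟_{λ,μ} = 𝒟_λ ∩ 𝒟_μ⁻¹` with the trivial intersection property
`d⁻¹ W_λ d ∩ W_μ = {1}`. -/
def dist₀ : Set (W r) :=
  {d | d ∈ lam.dist ∧ d⁻¹ ∈ mu.dist ∧
    ∀ g ∈ lam.quasiParabolic, d⁻¹ * g * d ∈ mu.quasiParabolic → d⁻¹ * g * d = 1}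

variable {R : Type*} [CommRing R] (q₀ q : Rˣ)

/-- `x_λ = π_a ∑_{w ∈ W̄_λ} T_w`, where `a = |λ⁽¹⁾|`. -/
def x : Hecke R r q₀ q :=
  piPlus q₀ q lam.size₁ * ∑ w ∈ Finset.univ.filter (fun w => w ∈ lam.young), T q₀ q w

/-- `y_λ = π_a⁻ ∑_{w ∈ W̄_λ} (-q)^{-ℓ(w)} T_w`, where `a = |λ⁽¹⁾|`. -/
def y : Hecke R r q₀ q :=
  piMinus q₀ q lam.size₁ * ∑ w ∈ Finset.univ.filter (fun w => w ∈ lam.young),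
    ((((-q)⁻¹ ^ length w : Rˣ) : R)) • T q₀ q w

end Bicomposition

/-! ### One-sided ideals, as `R`-submodules -/

section Ideals

variable (R : Type*) [CommRing R] {A : Type*} [Ring A] [Algebra R A]

/-- `x A = {x h | h ∈ A}`. -/
def rightIdeal (x : A) : Submodule R A := LinearMap.range (LinearMap.mulLeft R x)

/-- `A y = {h y | h ∈ A}`. -/
def leftIdeal (y : A) : Submodule R A := LinearMap.range (LinearMap.mulRight R y)

/-- `x A y = {x h y | h ∈ A}`. -/
def sandwich (x y : A) : Submodule R A :=
  LinearMap.range (LinearMap.mulRight R y ∘ₗ LinearMap.mulLeft R x)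

end Ideals

end HeckeB

end

/-! An element of `H'` is studied through its coefficients with respect to the basis `T_w`. Left
multiplication of `x_λ` by `T_s`, for `s` a generator of the Young subgroup, multiplies it by an
eigenvalue `κ`, and `T_{s_0}` acts on `π_a` (if `a > 0`) by `κ₀`; for `y_μ` the eigenvalues are `κ'`
and `κ₀'`. An equation `T_s h = κ h` ties the coefficients of `h` at `w` and `s w` by a unit. Hence,
by induction on length, the coefficients of an element of `x_λ H'` are determined by those on `𝒟_λ`,
and the anti-automorphism `T_w ↦ T_{w⁻¹}` gives the same on the right.

Let `h` lie in the intersection, let `w ∈ 𝒟_λ ∩ 𝒟_μ⁻¹` violate the trivial intersection property,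
and suppose that the coefficients at shorter elements vanish. Either `w` carries one of the first
`b` letters to one of the first `a`, and then some sign change satisfies `t w = w t'` with relations
from both sides (`coeff_flip_mul`); or there are generators of the two Young subgroups with `s w = w
s'` (`exists_common_reflection`). Comparing the two relations, `κ₀ - κ₀'` or `κ - κ'` kills the
coefficient at `w`. These differences are `±(q₀ + 1)` and `±(q + 1)`, which are not zero divisors.
So `h` is determined by its coefficients on `𝒟⁰` (`eq_zero_of_vanish`).

Conversely, on `𝒟⁰` the coefficients of the elements `x_λ T_d y_μ` form a unit multiple of the
identity matrix (`vec_elem_mul_T_mul_elem`): `π_a` is a unit plus terms that create negative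
letters, and the Young sums meet `𝒟⁰` only in `d`. Subtracting the right combination of these
elements from `h` leaves zero. This gives the equality of the ideals and the basis at once. The
statement about `π_a` and `π_b⁻` is the case of trivial Young subgroups. -/

noncomputable section

namespace HeckeB

/-! ### Signed permutations in window notation -/

section Window

variable {r : ℕ}

/-- The signed letter `w⁻¹ (i + 1)`, as an integer. -/
def window (w : W r) (i : Fin r) : ℤ :=
  ((w.left i : ℤˣ) : ℤ) * (((w.right⁻¹ i : Fin r) : ℕ) + 1 : ℤ)

lemma left_mul (g w : W r) (i : Fin r) :
    (g * w).left i = g.left i * w.left (g.right⁻¹ i) := by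
  simp [SemidirectProduct.mul_left, mulAutArrow]
  rfl

/-- This is `(g w)⁻¹ = w⁻¹ g⁻¹`. Left multiplication permutes the places of the window and changes
signs there, so left descents and left multiplication by `W_λ` can be read off from the window. -/
lemma window_mul (g w : W r) (i : Fin r) :
    window (g * w) i = (g.left i : ℤ) * window w (g.right⁻¹ i) := by
  simp only [window, left_mul, SemidirectProduct.mul_right, mul_inv_rev, Equiv.Perm.mul_apply]
  push_cast
  ring

lemma window_of_left_one {w : W r} {i : Fin r} (h : w.left i = 1) :
    window w i = ((w.right⁻¹ i : Fin r) : ℕ) + 1 := by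
  simp [window, h]

lemma window_of_left_neg {w : W r} {i : Fin r} (h : w.left i = -1) :
    window w i = -(((w.right⁻¹ i : Fin r) : ℕ) + 1) := by
  simp [window, h]

lemma window_pos_iff {w : W r} {i : Fin r} : 0 < window w i ↔ w.left i = 1 := by
  rcases Int.units_eq_one_or (w.left i) with h | h
  · simp only [window_of_left_one h, h, iff_true]; omega
  · simp only [window_of_left_neg h, h]
    constructor
    · intro h'; omega
    · intro h'; exact absurd h' (by decide)

lemma window_ne_zero (w : W r) (i : Fin r) : window w i ≠ 0 := by
  rcases Int.units_eq_one_or (w.left i) with h | h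
  · rw [window_of_left_one h]; omega
  · rw [window_of_left_neg h]; omega

lemma window_neg_iff {w : W r} {i : Fin r} : window w i < 0 ↔ w.left i = -1 := by
  rcases Int.units_eq_one_or (w.left i) with h | h
  · rw [window_of_left_one h, h]
    constructor
    · intro h'; omega
    · intro h'; exact absurd h' (by decide)
  · simp only [window_of_left_neg h, h, iff_true]; omega

lemma natAbs_window (w : W r) (i : Fin r) :
    (window w i).natAbs = (w.right⁻¹ i : Fin r) + 1 := by
  rcases Int.units_eq_one_or (w.left i) with h | h
  · rw [window_of_left_one h]; omega
  · rw [window_of_left_neg h]; omega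

lemma eq_of_natAbs_window {w : W r} {i j : Fin r}
    (h : (window w i).natAbs = (window w j).natAbs) : i = j := by
  rw [natAbs_window, natAbs_window] at h
  exact w.right⁻¹.injective (Fin.ext (by omega))

lemma window_injective {w w' : W r} (h : ∀ i, window w i = window w' i) : w = w' := by
  have h1 : w.right⁻¹ = w'.right⁻¹ := by
    ext i
    have := natAbs_window w i
    rw [h i, natAbs_window] at this
    omega
  have h2 : w.left = w'.left := by
    funext i
    rcases Int.units_eq_one_or (w.left i) with h3 | h3
    · rw [h3, eq_comm, ← window_pos_iff, ← h i, window_pos_iff, h3]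
    · rw [h3, eq_comm, ← window_neg_iff, ← h i, window_neg_iff, h3]
  exact SemidirectProduct.ext h2 (inv_injective h1)

/-- The sign change of one letter. -/
def flip (i : Fin r) : W r := ⟨Pi.mulSingle i (-1), 1⟩

/-- A permutation, as an element of the Weyl group. -/
def ofPerm (σ : Equiv.Perm (Fin r)) : W r := ⟨1, σ⟩

lemma s_zero {i : Fin r} (h : i.val = 0) : s i = flip i := by
  simp [s, h, flip]

lemma s_succ {p k : Fin r} (h : p.val + 1 = k.val) : s k = ofPerm (Equiv.swap p k) := by
  have h0 : k.val ≠ 0 := by omega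
  have h1 : (⟨k.val - 1, lt_of_le_of_lt (Nat.sub_le _ _) k.isLt⟩ : Fin r) = p :=
    Fin.ext (by simp; omega)
  simp only [s, h0, if_false, h1, ofPerm]

lemma exists_pred {k : Fin r} (h : k.val ≠ 0) : ∃ p : Fin r, p.val + 1 = k.val :=
  ⟨⟨k.val - 1, by omega⟩, by simp; omega⟩

@[simp] lemma flip_right (i : Fin r) : (flip i).right = 1 := rfl
@[simp] lemma ofPerm_right (σ : Equiv.Perm (Fin r)) : (ofPerm σ).right = σ := rfl
@[simp] lemma ofPerm_left (σ : Equiv.Perm (Fin r)) (i : Fin r) : (ofPerm σ).left i = 1 := rfl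
@[simp] lemma flip_left_self (i : Fin r) : (flip i).left i = -1 := by simp [flip]
lemma flip_left_ne {i j : Fin r} (h : j ≠ i) : (flip i).left j = 1 := by simp [flip, h]

lemma flip_mul_self (i : Fin r) : flip i * flip i = 1 := by
  apply SemidirectProduct.ext
  · funext j
    rw [left_mul]
    by_cases h : j = i
    · subst h; simp
    · simp [flip_left_ne h]
  · simp

lemma ofPerm_mul (σ τ : Equiv.Perm (Fin r)) : ofPerm σ * ofPerm τ = ofPerm (σ * τ) := by
  apply SemidirectProduct.ext
  · funext j; rw [left_mul]; simp
  · simp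

@[simp] lemma ofPerm_one : ofPerm (1 : Equiv.Perm (Fin r)) = 1 := rfl

lemma s_mul_self (i : Fin r) : s i * s i = 1 := by
  by_cases h : i.val = 0
  · rw [s_zero h, flip_mul_self]
  · obtain ⟨p, hp⟩ := exists_pred h
    rw [s_succ hp, ofPerm_mul, Equiv.swap_mul_self, ofPerm_one]

@[simp] lemma s_mul_s_mul (i : Fin r) (w : W r) : s i * (s i * w) = w := by
  rw [← mul_assoc, s_mul_self, one_mul]

@[simp] lemma mul_s_mul_s (i : Fin r) (w : W r) : w * s i * s i = w := by
  rw [mul_assoc, s_mul_self, mul_one]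

lemma s_inv (i : Fin r) : (s i)⁻¹ = s i := inv_eq_of_mul_eq_one_left (s_mul_self i)

lemma mul_flip (w : W r) (x : Fin r) : w * flip x = flip (w.right x) * w := by
  apply SemidirectProduct.ext
  · funext j
    rw [left_mul, left_mul]
    by_cases h : j = w.right x
    · subst h; simp [mul_comm]
    · have : w.right⁻¹ j ≠ x := fun h' => h (by rw [← h']; simp)
      rw [flip_left_ne h, flip_left_ne this, flip_right]
      simp
  · simp

/-- Equal signs are what makes the conjugate of a transposition a transposition again; with opposite
signs it would also change two signs. -/
lemma mul_swap (w : W r) {x y : Fin r} (h : w.left (w.right x) = w.left (w.right y)) :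
    w * ofPerm (Equiv.swap x y) = ofPerm (Equiv.swap (w.right x) (w.right y)) * w := by
  apply SemidirectProduct.ext
  · funext j
    rw [left_mul, left_mul]
    simp only [ofPerm_left, ofPerm_right, mul_one, one_mul, Equiv.swap_inv]
    rw [Equiv.swap_apply_def]
    split_ifs with h1 h2
    · rw [h1, h]
    · rw [h2, h]
    · rfl
  · simp only [SemidirectProduct.mul_right, ofPerm_right]
    exact Equiv.mul_swap_eq_swap_mul _ _ _

lemma window_flip_mul_self (w : W r) (i : Fin r) : window (flip i * w) i = -window w i := by
  simp [window_mul]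

lemma window_flip_mul_ne (w : W r) {i j : Fin r} (h : j ≠ i) :
    window (flip i * w) j = window w j := by
  simp [window_mul, flip_left_ne h]

lemma window_swap_mul (w : W r) (x y j : Fin r) :
    window (ofPerm (Equiv.swap x y) * w) j = window w (Equiv.swap x y j) := by
  simp [window_mul]

lemma window_one (i : Fin r) : window (1 : W r) i = i.val + 1 := by
  simp [window]

lemma window_flip_self (i : Fin r) : window (flip i) i = -(i.val + 1) := by
  have := window_flip_mul_self 1 i
  rwa [mul_one, window_one] at this

lemma window_flip_ne {i j : Fin r} (h : j ≠ i) : window (flip i) j = j.val + 1 := by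
  have := window_flip_mul_ne 1 h
  rwa [mul_one, window_one] at this

lemma flip_inv (i : Fin r) : (flip i)⁻¹ = flip i := inv_eq_of_mul_eq_one_left (flip_mul_self i)

/-- `w (i + 1) = ± (w.right i + 1)`. -/
lemma window_inv (w : W r) (i : Fin r) :
    window w⁻¹ i = (w.left (w.right i) : ℤ) * ((w.right i : ℕ) + 1) := by
  have h : w⁻¹.left i = w.left (w.right i) := by
    have h1 : (w⁻¹ * w).left i = 1 := by simp
    rw [left_mul] at h1
    have h2 : w⁻¹.left i = (w.left (w⁻¹.right⁻¹ i))⁻¹ := eq_inv_of_mul_eq_one_left h1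
    rw [h2, Int.units_inv_eq_self]
    simp
  simp [window, h]

lemma t_eq_flip (i : Fin r) : t i = flip i := by
  have : ∀ (k : ℕ) (h : k < r), tAux k h = flip ⟨k, h⟩ := by
    intro k
    induction k with
    | zero => intro h; rw [tAux, s_zero rfl]
    | succ k ih =>
      intro h
      have hp : (⟨k, Nat.lt_of_succ_lt h⟩ : Fin r).val + 1 = (⟨k + 1, h⟩ : Fin r).val := rfl
      rw [tAux, ih, s_succ hp, mul_flip, mul_assoc, ofPerm_mul]
      simp
  exact this i.val i.isLt

end Window

/-! ### The length as a number of inversions, and the exchange property -/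

section Length

variable {r : ℕ}

/-- An adjacent transposition keeps the order of every pair of places except `(p, k)`, so a sum over
ordered pairs changes in a single term. The additive form avoids subtraction in `ℕ`. -/
lemma sum_swap_adjacent (H : Fin r → Fin r → ℕ) {p k : Fin r} (hpk : p.val + 1 = k.val) :
    (∑ i, ∑ j, if i < j then H (Equiv.swap p k i) (Equiv.swap p k j) else 0) + H p k =
      (∑ i, ∑ j, if i < j then H i j else 0) + H k p := by
  have hne : p ≠ k := by rintro rfl; omega
  have e1 : (∑ i, ∑ j, if i < j then H (Equiv.swap p k i) (Equiv.swap p k j) else 0) =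
      ∑ x : Fin r × Fin r,
        if Equiv.swap p k x.1 < Equiv.swap p k x.2 then H x.1 x.2 else 0 := by
    rw [← Fintype.sum_prod_type']
    refine Fintype.sum_equiv ((Equiv.swap p k).prodCongr (Equiv.swap p k)) _ _ ?_
    rintro ⟨i, j⟩
    simp
  have e2 : (∑ i, ∑ j, if i < j then H i j else 0) =
      ∑ x : Fin r × Fin r, if x.1 < x.2 then H x.1 x.2 else 0 := by
    rw [← Fintype.sum_prod_type']
  have e3 : H p k = ∑ x : Fin r × Fin r, if x = (p, k) then H x.1 x.2 else 0 := by simp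
  have e4 : H k p = ∑ x : Fin r × Fin r, if x = (k, p) then H x.1 x.2 else 0 := by simp
  rw [e1, e2, e3, e4, ← Finset.sum_add_distrib, ← Finset.sum_add_distrib]
  refine Finset.sum_congr rfl ?_
  rintro ⟨i, j⟩ -
  simp only [Equiv.swap_apply_def, Prod.mk.injEq, Fin.ext_iff, Fin.lt_def] at hne ⊢
  split_ifs <;> omega

/-- The number of positive roots made negative. -/
def inversions (w : W r) : ℕ :=
  (∑ i, ∑ j, if i < j then ((if window w j < window w i then 1 else 0) +
    (if window w i + window w j < 0 then 1 else 0)) else 0) +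
  ∑ i, if window w i < 0 then 1 else 0

lemma inversions_s_succ (w : W r) {p k : Fin r} (hpk : p.val + 1 = k.val) :
    inversions (s k * w) + (if window w k < window w p then 1 else 0) =
      inversions w + (if window w p < window w k then 1 else 0) := by
  have h1 := sum_swap_adjacent (fun i j => (if window w j < window w i then 1 else 0) +
    (if window w i + window w j < 0 then 1 else 0)) hpk
  have h2 : (∑ i, if window w (Equiv.swap p k i) < 0 then 1 else 0) =
      ∑ i, if window w i < 0 then 1 else 0 :=
    Equiv.sum_comp (Equiv.swap p k) (fun i => if window w i < 0 then 1 else 0)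
  simp only [inversions, s_succ hpk, window_swap_mul]
  rw [h2]
  rw [add_comm (window w k) (window w p)] at h1
  omega

/-- Negating the entry at the first place interchanges the conditions `w_y < w_i` and `w_i + w_y <
0`, so the pairs contribute the same total and only the count of negative entries changes. -/
lemma inversions_s_zero (w : W r) {i : Fin r} (hi : i.val = 0) :
    inversions (s i * w) + (if window w i < 0 then 1 else 0) =
      inversions w + (if 0 < window w i then 1 else 0) := by
  have h1 : (∑ x, ∑ y, if x < y then
      ((if window (flip i * w) y < window (flip i * w) x then 1 else 0) +
      (if window (flip i * w) x + window (flip i * w) y < 0 then 1 else 0)) else 0) =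
      ∑ x, ∑ y, if x < y then ((if window w y < window w x then 1 else 0) +
      (if window w x + window w y < 0 then 1 else 0)) else 0 := by
    refine Finset.sum_congr rfl fun x _ => Finset.sum_congr rfl fun y _ => ?_
    by_cases hxy : x < y
    · have hy : y ≠ i := by rintro rfl; rw [Fin.lt_def] at hxy; omega
      rw [if_pos hxy, if_pos hxy, window_flip_mul_ne w hy]
      by_cases hx : x = i
      · subst hx
        rw [window_flip_mul_self]
        split_ifs <;> omega
      · rw [window_flip_mul_ne w hx]
    · rw [if_neg hxy, if_neg hxy]
  have h2 : (∑ x, if window (flip i * w) x < 0 then 1 else 0) + (if window w i < 0 then 1 else 0) =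
      (∑ x, if window w x < 0 then 1 else 0) + (if 0 < window w i then 1 else 0) := by
    rw [← Finset.add_sum_erase _ _ (Finset.mem_univ i),
      ← Finset.add_sum_erase (a := i) _ (fun x => if window w x < 0 then 1 else 0)
        (Finset.mem_univ i)]
    have h3 : (∑ x ∈ Finset.univ.erase i, if window (flip i * w) x < 0 then 1 else 0) =
        ∑ x ∈ Finset.univ.erase i, if window w x < 0 then 1 else 0 :=
      Finset.sum_congr rfl fun x hx => by
        rw [window_flip_mul_ne w (Finset.ne_of_mem_erase hx)]
    rw [h3, window_flip_mul_self]
    split_ifs <;> omega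
  simp only [inversions, s_zero hi]
  rw [h1]
  omega

/-- `s i` is not a left descent of `w`. -/
def Asc (i : Fin r) (w : W r) : Prop := length w < length (s i * w)

lemma inversions_one : inversions (1 : W r) = 0 := by
  simp only [inversions, window_one]
  rw [Nat.add_eq_zero_iff]
  constructor
  · refine Finset.sum_eq_zero fun i _ => Finset.sum_eq_zero fun j _ => ?_
    simp only [Fin.lt_def]
    split_ifs <;> omega
  · refine Finset.sum_eq_zero fun i _ => if_neg (by omega)

/-- Increasing positive integers satisfy `w_n ≥ n + 1` (counting from `0`); the bound `r` on the
last entry, followed downwards, gives the opposite inequality. -/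
lemma eq_one_of_window_increasing {w : W r} (h0 : ∀ i : Fin r, i.val = 0 → 0 < window w i)
    (h1 : ∀ p k : Fin r, p.val + 1 = k.val → window w p < window w k) : w = 1 := by
  have hlow : ∀ n : ℕ, ∀ h : n < r, (n : ℤ) + 1 ≤ window w ⟨n, h⟩ := by
    intro n
    induction n with
    | zero => intro h; have := h0 ⟨0, h⟩ rfl; push_cast; omega
    | succ n ih =>
      intro h
      have h2 := ih (by omega)
      have h3 := h1 ⟨n, by omega⟩ ⟨n + 1, h⟩ rfl
      push_cast at *
      omega
  have hhigh : ∀ m : ℕ, ∀ n : ℕ, ∀ h : n < r, n + m + 1 = r → window w ⟨n, h⟩ ≤ (n : ℤ) + 1 := by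
    intro m
    induction m with
    | zero =>
      intro n h hn
      have h2 := natAbs_window w ⟨n, h⟩
      have h3 := (w.right⁻¹ ⟨n, h⟩).isLt
      omega
    | succ m ih =>
      intro n h hn
      have h2 := ih (n + 1) (by omega) (by omega)
      have h3 := h1 ⟨n, by omega⟩ ⟨n + 1, by omega⟩ rfl
      push_cast at *
      omega
  refine window_injective fun i => ?_
  rw [window_one]
  exact le_antisymm (hhigh (r - 1 - i.val) i.val i.isLt (by omega)) (hlow i.val i.isLt)

lemma inversions_s_mul (i : Fin r) (w : W r) :
    inversions (s i * w) = inversions w + 1 ∨ inversions (s i * w) + 1 = inversions w := by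
  by_cases h : i.val = 0
  · have := inversions_s_zero w h
    have h1 := window_ne_zero w i
    split_ifs at this <;> omega
  · obtain ⟨p, hp⟩ := exists_pred h
    have := inversions_s_succ w hp
    have h1 : window w p ≠ window w i := fun h2 => by
      have := eq_of_natAbs_window (w := w) (i := p) (j := i) (by rw [h2])
      subst this; omega
    split_ifs at this <;> omega

lemma exists_inversions_lt {w : W r} (hw : w ≠ 1) :
    ∃ i, inversions (s i * w) + 1 = inversions w := by
  by_contra! hcon
  refine hw (eq_one_of_window_increasing ?_ ?_)
  · intro i hi
    have h1 := inversions_s_zero w hi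
    have h2 := window_ne_zero w i
    have h3 := hcon i
    split_ifs at h1 <;> omega
  · intro p k hpk
    have h1 := inversions_s_succ w hpk
    have h3 := hcon k
    have h2 : window w p ≠ window w k := fun h2 => by
      have := eq_of_natAbs_window (w := w) (i := p) (j := k) (by rw [h2])
      subst this; omega
    split_ifs at h1 <;> omega

lemma exists_word (w : W r) : ∃ l : List (Fin r), IsWord w l ∧ l.length = inversions w := by
  induction h : inversions w generalizing w with
  | zero =>
    by_cases hw : w = 1
    · subst hw; exact ⟨[], by simp [IsWord], rfl⟩
    · obtain ⟨i, hi⟩ := exists_inversions_lt hw; omega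
  | succ n ih =>
    by_cases hw : w = 1
    · subst hw; rw [inversions_one] at h; omega
    · obtain ⟨i, hi⟩ := exists_inversions_lt hw
      obtain ⟨l, hl, hn⟩ := ih (s i * w) (by omega)
      refine ⟨i :: l, ?_, by simp [hn]⟩
      unfold IsWord at hl ⊢
      rw [List.map_cons, List.prod_cons, hl, s_mul_s_mul]

lemma inversions_le_of_isWord {w : W r} {l : List (Fin r)} (h : IsWord w l) :
    inversions w ≤ l.length := by
  induction l generalizing w with
  | nil => simp only [IsWord, List.map_nil, List.prod_nil] at h; subst h; simp [inversions_one]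
  | cons i l ih =>
    simp only [IsWord, List.map_cons, List.prod_cons] at h
    subst h
    have h1 := ih (w := (l.map s).prod) rfl
    have h2 := inversions_s_mul i (l.map s).prod
    simp only [List.length_cons]
    omega

/-- A simple reflection changes the number of inversions by exactly one, and every `w ≠ 1` has one
that lowers it. -/
lemma length_eq_inversions (w : W r) : length w = inversions w := by
  apply le_antisymm
  · exact Nat.sInf_le (exists_word w)
  · obtain ⟨l, hl, hn⟩ := Nat.sInf_mem (s := {k | ∃ l : List (Fin r), IsWord w l ∧ l.length = k})
      ⟨_, exists_word w⟩
    have := inversions_le_of_isWord hl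
    rw [hn] at this
    exact this

lemma reducedWord_spec (w : W r) : IsWord w (reducedWord w) ∧ (reducedWord w).length = length w := by
  have h : ∃ l : List (Fin r), IsWord w l ∧ l.length = length w := by
    rw [length_eq_inversions]; exact exists_word w
  exact Classical.epsilon_spec h

lemma length_le_of_isWord {w : W r} {l : List (Fin r)} (h : IsWord w l) : length w ≤ l.length := by
  rw [length_eq_inversions]; exact inversions_le_of_isWord h

@[simp] lemma length_one : length (1 : W r) = 0 := by rw [length_eq_inversions, inversions_one]

lemma asc_zero {i : Fin r} (hi : i.val = 0) (w : W r) : Asc i w ↔ 0 < window w i := by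
  have h1 := inversions_s_zero w hi
  have h2 := window_ne_zero w i
  rw [Asc, length_eq_inversions, length_eq_inversions]
  split_ifs at h1 <;> omega

lemma window_ne {w : W r} {p k : Fin r} (h : p ≠ k) : window w p ≠ window w k := fun h2 =>
  h (eq_of_natAbs_window (w := w) (by rw [h2]))

lemma asc_succ {p k : Fin r} (hpk : p.val + 1 = k.val) (w : W r) :
    Asc k w ↔ window w p < window w k := by
  have h1 := inversions_s_succ w hpk
  have h2 : window w p ≠ window w k := window_ne (by rintro rfl; omega)
  rw [Asc, length_eq_inversions, length_eq_inversions]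
  split_ifs at h1 <;> omega

lemma Asc.length_eq {i : Fin r} {w : W r} (h : Asc i w) : length (s i * w) = length w + 1 := by
  have := inversions_s_mul i w
  rw [Asc] at h
  rw [length_eq_inversions, length_eq_inversions] at *
  omega

lemma length_of_not_asc {i : Fin r} {w : W r} (h : ¬ Asc i w) :
    length (s i * w) + 1 = length w := by
  have := inversions_s_mul i w
  rw [Asc] at h
  rw [length_eq_inversions, length_eq_inversions] at *
  omega

lemma asc_s_mul {i : Fin r} {w : W r} : Asc i (s i * w) ↔ ¬ Asc i w := by
  by_cases h : Asc i w
  · have := h.length_eq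
    simp only [Asc, s_mul_s_mul] at h ⊢; omega
  · have := length_of_not_asc h
    simp only [Asc, s_mul_s_mul] at h ⊢; omega

lemma length_s_mul_le (i : Fin r) (w : W r) : length (s i * w) ≤ length w + 1 := by
  have := inversions_s_mul i w
  rw [length_eq_inversions, length_eq_inversions]
  omega

lemma exists_not_asc {w : W r} (hw : w ≠ 1) : ∃ i, ¬ Asc i w := by
  obtain ⟨i, hi⟩ := exists_inversions_lt hw
  refine ⟨i, ?_⟩
  rw [Asc, length_eq_inversions, length_eq_inversions]; omega

lemma length_inv_le (w : W r) : length w⁻¹ ≤ length w := by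
  obtain ⟨h1, h2⟩ := reducedWord_spec w
  rw [← h2, ← List.length_reverse]
  apply length_le_of_isWord
  unfold IsWord at h1 ⊢
  have h3 : (reducedWord w).map s = ((reducedWord w).map s).map fun x => x⁻¹ := by
    rw [List.map_map]
    exact List.map_congr_left fun i _ => (s_inv i).symm
  rw [List.map_reverse, h3, ← List.prod_inv_reverse, h1]

@[simp] lemma length_inv (w : W r) : length w⁻¹ = length w :=
  le_antisymm (length_inv_le w) (by simpa using length_inv_le w⁻¹)

lemma asc_inv {i : Fin r} {w : W r} : Asc i w⁻¹ ↔ length w < length (w * s i) := by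
  rw [Asc, ← length_inv (w * s i), mul_inv_rev, s_inv, length_inv]

/-- The exchange property in the form needed for the regular representations to commute. -/
lemma s_mul_eq_mul_s {i j : Fin r} {w : W r} (h1 : Asc i w) (h2 : ¬ Asc i (w * s j)) :
    s i * w = w * s j := by
  by_cases hi : i.val = 0
  · rw [asc_zero hi] at h1 h2
    rw [window_pos_iff] at h1 h2
    rw [left_mul, h1, one_mul] at h2
    by_cases hj : j.val = 0
    · rw [s_zero hj] at h2 ⊢
      have h3 : w.right⁻¹ i = j := by
        by_contra h3; exact h2 (flip_left_ne h3)
      rw [s_zero hi, mul_flip, ← h3]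
      simp
    · obtain ⟨p, hp⟩ := exists_pred hj
      rw [s_succ hp] at h2
      simp at h2
  · obtain ⟨p, hp⟩ := exists_pred hi
    rw [asc_succ hp] at h1 h2
    have hne : p ≠ i := by rintro rfl; omega
    set x := w.right⁻¹ p with hx
    set y := w.right⁻¹ i with hy
    have hxy : x ≠ y := fun h => hne (w.right⁻¹.injective h)
    have hxy' : x.val ≠ y.val := fun h => hxy (Fin.ext h)
    have hwx : w.right x = p := by simp [hx]
    have hwy : w.right y = i := by simp [hy]
    simp only [window_mul] at h2
    rw [← hx, ← hy] at h2
    simp only [window] at h1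
    rw [← hx, ← hy] at h1
    by_cases hj : j.val = 0
    · exfalso
      -- Right multiplication by `s_0` only negates the entry of absolute value `1`. Any other entry
      -- has absolute value at least `2`, so no order relation changes.
      apply h2
      rw [s_zero hj]
      by_cases h3 : x = j
      · have h4 : y ≠ j := fun h => hxy (h3.trans h.symm)
        rw [h3, window_flip_self, window_flip_ne h4]
        rcases Int.units_eq_one_or (w.left p) with h5 | h5 <;>
        rcases Int.units_eq_one_or (w.left i) with h6 | h6 <;>
        rw [h5, h6] at h1 ⊢ <;> push_cast at h1 ⊢ <;> omega
      · rw [window_flip_ne h3]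
        by_cases h4 : y = j
        · rw [h4, window_flip_self]
          rcases Int.units_eq_one_or (w.left p) with h5 | h5 <;>
          rcases Int.units_eq_one_or (w.left i) with h6 | h6 <;>
          rw [h5, h6] at h1 ⊢ <;> push_cast at h1 ⊢ <;> omega
        · rw [window_flip_ne h4]; exact h1
    · obtain ⟨m, hm⟩ := exists_pred hj
      have hs : ∀ z, window (s j) z = (Equiv.swap m j z).val + 1 := fun z => by
        rw [← mul_one (s j), s_succ hm, window_swap_mul, window_one]
      rw [hs, hs] at h2
      -- Right multiplication by `s_j` interchanges two consecutive absolute values; this reverses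
      -- the order of two entries only if they are those two, with equal signs.
      have key : w.left p = w.left i ∧ ((x = m ∧ y = j) ∨ (x = j ∧ y = m)) := by
        simp only [Equiv.swap_apply_def, Fin.ext_iff] at h2 ⊢
        rcases Int.units_eq_one_or (w.left p) with h5 | h5 <;>
        rcases Int.units_eq_one_or (w.left i) with h6 | h6 <;>
        rw [h5, h6] at h1 h2 ⊢ <;> push_cast at h1 h2 <;> split_ifs at h2 <;>
        first | omega | exact ⟨rfl, by omega⟩
      obtain ⟨hk, hk'⟩ := key
      have hsw : Equiv.swap m j = Equiv.swap x y := by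
        rcases hk' with ⟨h3, h4⟩ | ⟨h3, h4⟩
        · rw [h3, h4]
        · rw [h3, h4, Equiv.swap_comm]
      rw [s_succ hp, s_succ hm, hsw, mul_swap w (by rw [hwx, hwy, hk]), hwx, hwy]

end Length

end HeckeB

namespace HeckeB

/-! ### Quasi-parabolic subgroups, distinguished representatives and `𝒟⁰` -/

section Blocks

variable {r : ℕ}

/-- The standard parabolic subgroup of `𝔖_r` whose blocks are separated by the elements of `P`. -/
def youngOf (P : Set ℕ) : Subgroup (W r) :=
  Subgroup.closure {w | ∃ i : Fin r, i.val ≠ 0 ∧ i.val ∉ P ∧ w = s i}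

/-- The group of the sign changes of the first `a` letters. -/
def signsOf (a : ℕ) : Subgroup (W r) :=
  Subgroup.closure {w | ∃ i : Fin r, i.val < a ∧ w = t i}

def quasiParabolicOf (a : ℕ) (P : Set ℕ) : Subgroup (W r) := signsOf a ⊔ youngOf P

def distOf (a : ℕ) (P : Set ℕ) : Set (W r) :=
  {d | ∀ g ∈ quasiParabolicOf a P, g ≠ 1 → length d < length (g * d)}

def dist₀Of (a : ℕ) (P : Set ℕ) (b : ℕ) (Q : Set ℕ) : Set (W r) :=
  {d | d ∈ distOf a P ∧ d⁻¹ ∈ distOf b Q ∧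
    ∀ g ∈ quasiParabolicOf a P, d⁻¹ * g * d ∈ quasiParabolicOf b Q → d⁻¹ * g * d = 1}

/-- No element of `P` separates `i` and `j`. -/
def SameBlock (P : Set ℕ) (i j : ℕ) : Prop := ∀ m ∈ P, i < m ↔ j < m

lemma SameBlock.symm {P : Set ℕ} {i j : ℕ} (h : SameBlock P i j) : SameBlock P j i :=
  fun m hm => (h m hm).symm

lemma SameBlock.trans {P : Set ℕ} {i j k : ℕ} (h : SameBlock P i j) (h' : SameBlock P j k) :
    SameBlock P i k :=
  fun m hm => (h m hm).trans (h' m hm)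

lemma SameBlock.of_between {P : Set ℕ} {i j k l : ℕ} (h : SameBlock P i l) (hij : i ≤ j)
    (hjl : j ≤ l) (hik : i ≤ k) (hkl : k ≤ l) : SameBlock P j k := by
  intro m hm
  have := h m hm
  omega

lemma SameBlock.not_mem {P : Set ℕ} {p k : ℕ} (h : SameBlock P p k) (hpk : p + 1 = k) : k ∉ P := by
  intro hk
  have := h k hk
  omega

lemma sameBlock_of_not_mem {P : Set ℕ} {p k : ℕ} (hpk : p + 1 = k) (hk : k ∉ P) :
    SameBlock P p k := by
  intro m hm
  have : m ≠ k := fun h => hk (h ▸ hm)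
  omega

/-- The elements which preserve the blocks and change only signs of the first `a` letters. -/
def blockSubgroup (a : ℕ) (P : Set ℕ) : Subgroup (W r) where
  carrier := {g | (∀ i : Fin r, a ≤ i.val → g.left i = 1) ∧
    ∀ i : Fin r, SameBlock (insert a P) i (g.right i)}
  one_mem' := ⟨fun i _ => by simp, fun i m _ => by simp⟩
  mul_mem' := by
    rintro g h ⟨hg1, hg2⟩ ⟨hh1, hh2⟩
    refine ⟨fun i hi => ?_, fun i => ?_⟩
    · have h1 := hg2 (g.right⁻¹ i) a (Set.mem_insert _ _)
      rw [← Equiv.Perm.mul_apply, mul_inv_cancel, Equiv.Perm.one_apply] at h1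
      rw [left_mul, hg1 i hi, hh1 _ (by omega), one_mul]
    · rw [SemidirectProduct.mul_right, Equiv.Perm.mul_apply]
      exact (hh2 i).trans (hg2 _)
  inv_mem' := by
    rintro g ⟨hg1, hg2⟩
    refine ⟨fun i hi => ?_, fun i => ?_⟩
    · have h1 := hg2 i a (Set.mem_insert _ _)
      have h2 := hg1 (g.right i) (by omega)
      rw [← window_pos_iff, window_inv, h2]
      push_cast
      omega
    · have h1 := (hg2 (g.right⁻¹ i)).symm
      rwa [← Equiv.Perm.mul_apply, mul_inv_cancel, Equiv.Perm.one_apply] at h1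

lemma s_mem_blockSubgroup {a : ℕ} {P : Set ℕ} {k : Fin r} (h0 : k.val ≠ 0)
    (hk : k.val ∉ insert a P) : s k ∈ blockSubgroup a P := by
  obtain ⟨p, hp⟩ := exists_pred h0
  have hb := sameBlock_of_not_mem hp hk
  rw [s_succ hp]
  refine ⟨fun i _ => by simp, fun i => ?_⟩
  rw [ofPerm_right, Equiv.swap_apply_def]
  split_ifs with h1 h2
  · rw [h1]; exact hb
  · rw [h2]; exact hb.symm
  · intro m _; rfl

lemma youngOf_spec {P : Set ℕ} {g : W r} (hg : g ∈ youngOf P) :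
    (∀ i : Fin r, g.left i = 1) ∧ ∀ i : Fin r, SameBlock P i (g.right i) := by
  -- For `a = 0` no sign may change, and the additional separator `0` separates nothing.
  have h : youngOf P ≤ blockSubgroup (r := r) 0 P := by
    refine (Subgroup.closure_le _).2 ?_
    rintro w ⟨i, h0, hi, rfl⟩
    exact s_mem_blockSubgroup h0 (by simp [h0, hi])
  obtain ⟨h1, h2⟩ := h hg
  exact ⟨fun i => h1 i (Nat.zero_le _), fun i m hm => h2 i m (Set.mem_insert_of_mem _ hm)⟩

lemma quasiParabolicOf_spec {a : ℕ} {P : Set ℕ} (ha : a ∈ P) {g : W r}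
    (hg : g ∈ quasiParabolicOf a P) :
    (∀ i : Fin r, a ≤ i.val → g.left i = 1) ∧ ∀ i : Fin r, SameBlock P i (g.right i) := by
  have h : quasiParabolicOf a P ≤ blockSubgroup (r := r) a P := by
    refine sup_le ((Subgroup.closure_le _).2 ?_) ((Subgroup.closure_le _).2 ?_)
    · rintro w ⟨i, hi, rfl⟩
      rw [t_eq_flip]
      refine ⟨fun j hj => flip_left_ne (by rintro rfl; omega), fun j m _ => by simp⟩
    · rintro w ⟨i, h0, hi, rfl⟩
      exact s_mem_blockSubgroup h0 (by rwa [Set.insert_eq_of_mem ha])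
  obtain ⟨h1, h2⟩ := h hg
  exact ⟨h1, fun i m hm => h2 i m (Set.mem_insert_of_mem _ hm)⟩

lemma s_mem_youngOf {P : Set ℕ} {k : Fin r} (h0 : k.val ≠ 0) (hk : k.val ∉ P) : s k ∈ youngOf P :=
  Subgroup.subset_closure ⟨k, h0, hk, rfl⟩

lemma youngOf_le (a : ℕ) (P : Set ℕ) : youngOf (r := r) P ≤ quasiParabolicOf a P := le_sup_right

lemma flip_mem_quasiParabolicOf {a : ℕ} (P : Set ℕ) {i : Fin r} (hi : i.val < a) :
    flip i ∈ quasiParabolicOf a P := by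
  have : flip i ∈ signsOf a := Subgroup.subset_closure ⟨i, hi, (t_eq_flip i).symm⟩
  exact (le_sup_left : signsOf a ≤ quasiParabolicOf a P) this

lemma swap_mem_youngOf_of_lt {P : Set ℕ} (n : ℕ) : ∀ {i j : Fin r}, i.val + n + 1 = j.val →
    SameBlock P i j → ofPerm (Equiv.swap i j) ∈ youngOf P := by
  induction n with
  | zero =>
    intro i j hij h
    rw [← s_succ hij]
    exact s_mem_youngOf (by omega) (h.not_mem hij)
  | succ n ih =>
    intro i j hij h
    obtain ⟨p, hp⟩ := exists_pred (k := j) (by omega)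
    have h1 := ih (i := i) (j := p) (by omega) (h.of_between le_rfl (by omega) (by omega) (by omega))
    have h2 : s j ∈ youngOf P := s_mem_youngOf (by omega)
      (SameBlock.not_mem (h.of_between (j := p) (k := j) (by omega) (by omega) (by omega) (by omega)) hp)
    rw [s_succ hp] at h2
    have h3 := mul_swap (ofPerm (Equiv.swap p j)) (x := i) (y := p) (by simp)
    have hip : i ≠ p := by rintro rfl; omega
    have hij' : i ≠ j := by rintro rfl; omega
    simp only [ofPerm_right, Equiv.swap_apply_left, Equiv.swap_apply_of_ne_of_ne hip hij'] at h3
    have h4 := eq_mul_inv_of_mul_eq h3.symm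
    rw [h4]
    exact mul_mem (mul_mem h2 h1) (inv_mem h2)

lemma swap_mem_youngOf {P : Set ℕ} {i j : Fin r} (h : SameBlock P i j) :
    ofPerm (Equiv.swap i j) ∈ youngOf P := by
  rcases lt_trichotomy i.val j.val with h1 | h1 | h1
  · exact swap_mem_youngOf_of_lt (j.val - i.val - 1) (by omega) h
  · have : i = j := Fin.ext h1
    subst this
    rw [Equiv.swap_self]
    exact one_mem _
  · rw [Equiv.swap_comm]
    exact swap_mem_youngOf_of_lt (i.val - j.val - 1) (by omega) h.symm

/-- The window is positive on the first `a` letters and increasing on the blocks. -/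
structure Normal (a : ℕ) (P : Set ℕ) (w : W r) : Prop where
  pos : ∀ i : Fin r, i.val < a → 0 < window w i
  step : ∀ p k : Fin r, p.val + 1 = k.val → k.val ∉ P → window w p < window w k

lemma Normal.window_lt {a : ℕ} {P : Set ℕ} {w : W r} (h : Normal a P w) {i j : Fin r}
    (hij : i < j) (hb : SameBlock P i j) : window w i < window w j := by
  obtain ⟨n, hn⟩ : ∃ n, i.val + n + 1 = j.val := ⟨j.val - i.val - 1, by rw [Fin.lt_def] at hij; omega⟩
  clear hij
  induction n generalizing j with
  | zero => exact h.step i j hn (hb.not_mem hn)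
  | succ n ih =>
    obtain ⟨p, hp⟩ := exists_pred (k := j) (by omega)
    refine (ih (j := p) (hb.of_between le_rfl (by omega) (by omega) (by omega)) (by omega)).trans
      (h.step p j hp (SameBlock.not_mem
        (hb.of_between (j := p) (k := j) (by omega) (by omega) (by omega) (by omega)) hp))

/-- If `i` is the least point that is not fixed, then `τ i` and `τ⁻¹ i` both exceed `i`. As `i` and
`τ⁻¹ i` share a block, monotonicity gives `τ i < i`, a contradiction. -/
lemma perm_eq_one_of_monotone_on_blocks {P : Set ℕ} {τ : Equiv.Perm (Fin r)}
    (hb : ∀ i : Fin r, SameBlock P i (τ i))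
    (hm : ∀ i j : Fin r, i < j → SameBlock P i j → τ i < τ j) : τ = 1 := by
  refine Equiv.ext fun i => ?_
  rw [Equiv.Perm.one_apply]
  induction i using WellFoundedLT.induction with
  | ind i ih =>
    by_contra hne
    have h1 : i < τ i := by
      refine lt_of_le_of_ne (not_lt.1 fun h => hne ?_) (Ne.symm hne)
      exact τ.injective (ih _ h)
    have h2 : τ (τ⁻¹ i) = i := by simp
    have h3 : i < τ⁻¹ i := by
      refine lt_of_le_of_ne (not_lt.1 fun h => ?_) fun h => hne ?_
      · have := ih _ h
        rw [h2] at this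
        rw [← this] at h
        exact lt_irrefl _ h
      · rw [← h] at h2; exact h2
    have h4 := hb (τ⁻¹ i)
    rw [h2] at h4
    have h5 := hm _ _ h3 h4.symm
    rw [h2] at h5
    exact lt_asymm h1 h5

/-- A coset contains at most one normal element: positivity on the first `a` places forces `g` to
have no signs, and a permutation within blocks between two windows that increase on the blocks is
the identity. -/
lemma Normal.eq_one {a : ℕ} {P : Set ℕ} (ha : a ∈ P) {g d : W r} (hg : g ∈ quasiParabolicOf a P)
    (hd : Normal a P d) (hgd : Normal a P (g * d)) : g = 1 := by
  obtain ⟨hg1, hg2⟩ := quasiParabolicOf_spec ha hg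
  have hg3 : ∀ i : Fin r, SameBlock P i (g.right⁻¹ i) := fun i => by
    have h1 := (hg2 (g.right⁻¹ i)).symm
    rwa [← Equiv.Perm.mul_apply, mul_inv_cancel, Equiv.Perm.one_apply] at h1
  have hl : ∀ i, g.left i = 1 := fun i => by
    by_cases hi : a ≤ i.val
    · exact hg1 i hi
    · have h1 := hgd.pos i (by omega)
      have h2 := hd.pos (g.right⁻¹ i) (by have := hg3 i a ha; omega)
      rw [window_mul] at h1
      rcases Int.units_eq_one_or (g.left i) with h | h
      · exact h
      · rw [h] at h1; push_cast at h1; omega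
  have hw : ∀ i, window (g * d) i = window d (g.right⁻¹ i) := fun i => by
    rw [window_mul, hl]; simp
  have hr : g.right⁻¹ = 1 := by
    refine perm_eq_one_of_monotone_on_blocks hg3 fun i j hij hb => ?_
    have h1 := hgd.window_lt hij hb
    rw [hw, hw] at h1
    by_contra h2
    have h3 : g.right⁻¹ j ≠ g.right⁻¹ i := fun h => (ne_of_gt hij) (g.right⁻¹.injective h)
    have h4 := hd.window_lt (lt_of_le_of_ne (not_lt.1 h2) h3)
      ((hg3 j).symm.trans (hb.symm.trans (hg3 i)))
    omega
  exact SemidirectProduct.ext (funext hl) (by simpa using hr)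

lemma s_mul_flip {p i : Fin r} (hp : p.val + 1 = i.val) : s i * flip p = flip i * s i := by
  rw [s_succ hp, mul_flip, ofPerm_right, Equiv.swap_apply_left]

/-- The first negative letter among the first `a` ones. -/
lemma exists_first_neg {a : ℕ} {w : W r} (h : ∃ i : Fin r, i.val < a ∧ window w i < 0) :
    ∃ i : Fin r, i.val < a ∧ window w i < 0 ∧ ∀ k < i, 0 < window w k := by
  obtain ⟨i, hi, hw⟩ := h
  induction i using WellFoundedLT.induction with
  | ind i ih =>
    by_cases hk : ∃ k < i, window w k < 0
    · obtain ⟨k, hki, hk⟩ := hk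
      exact ih k hki (by rw [Fin.lt_def] at hki; omega) hk
    · push Not at hk
      exact ⟨i, hi, hw, fun k hki => lt_of_le_of_ne (hk k hki) (window_ne_zero w k).symm⟩

/-- The negative entry is moved to the left with `t_i = s t_{i-1} s`. Its left neighbour is
positive, so the first `s` shortens `w`; the last `s` adds at most one. -/
lemma length_flip_mul_lt (n : ℕ) : ∀ {i : Fin r}, i.val = n → ∀ {w : W r}, window w i < 0 →
    (∀ k < i, 0 < window w k) → length (flip i * w) < length w := by
  induction n with
  | zero =>
    intro i hi w h1 _
    have h2 : ¬ Asc i w := by rw [asc_zero hi]; omega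
    rw [← s_zero hi]
    have := length_of_not_asc h2
    omega
  | succ n ih =>
    intro i hi w h1 h2
    obtain ⟨p, hp⟩ := exists_pred (k := i) (by omega)
    have hpi : p < i := by rw [Fin.lt_def]; omega
    have h3 : ¬ Asc i w := by rw [asc_succ hp]; have := h2 p hpi; omega
    have h4 := ih (i := p) (by omega) (w := s i * w)
      (by rw [s_succ hp, window_swap_mul, Equiv.swap_apply_left]; exact h1)
      (fun k hk => by
        rw [s_succ hp, window_swap_mul,
          Equiv.swap_apply_of_ne_of_ne (ne_of_lt hk) (ne_of_lt (hk.trans hpi))]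
        exact h2 k (hk.trans hpi))
    have h5 : flip i * w = s i * (flip p * (s i * w)) := by
      rw [← mul_assoc (s i), s_mul_flip hp, mul_assoc, s_mul_s_mul]
    have h6 := length_s_mul_le i (flip p * (s i * w))
    have h7 := length_of_not_asc h3
    rw [h5]
    omega

lemma Normal.of_length_le {a : ℕ} {P : Set ℕ} {w : W r}
    (h : ∀ g ∈ quasiParabolicOf a P, length w ≤ length (g * w)) : Normal a P w := by
  constructor
  · by_contra! hcon
    obtain ⟨i, hi, hw⟩ := hcon
    obtain ⟨j, hj, h1, h2⟩ := exists_first_neg ⟨i, hi, lt_of_le_of_ne hw (window_ne_zero w i)⟩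
    have h3 := h _ (flip_mem_quasiParabolicOf P hj)
    have h4 := length_flip_mul_lt _ rfl h1 h2
    omega
  · intro p k hpk hk
    rw [← asc_succ hpk]
    by_contra h1
    have h2 := h (s k) (youngOf_le a P (s_mem_youngOf (by omega) hk))
    have h3 := length_of_not_asc h1
    omega

/-- A shortest element of the coset is normal, and normal elements of a coset are unique. Thus no
additivity of lengths is needed for `W_λ`, which need not be a standard parabolic subgroup. -/
lemma mem_distOf_iff {a : ℕ} {P : Set ℕ} (ha : a ∈ P) {d : W r} :
    d ∈ distOf a P ↔ Normal a P d := by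
  constructor
  · intro h
    refine Normal.of_length_le fun g hg => ?_
    by_cases hg1 : g = 1
    · rw [hg1, one_mul]
    · exact (h g hg hg1).le
  · intro hd
    obtain ⟨⟨g₀, hg₀⟩, -, hmin⟩ := Finset.exists_min_image
      (Finset.univ : Finset (quasiParabolicOf (r := r) a P)) (fun g => length (g.1 * d))
      ⟨1, Finset.mem_univ _⟩
    have hmin' : ∀ g ∈ quasiParabolicOf a P, length (g₀ * d) ≤ length (g * d) :=
      fun g hg => hmin ⟨g, hg⟩ (Finset.mem_univ _)
    have hnorm : ∀ g ∈ quasiParabolicOf a P, length (g * d) ≤ length (g₀ * d) →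
        g = 1 := by
      intro g hg hle
      refine Normal.eq_one ha hg hd (Normal.of_length_le fun g' hg' => ?_)
      rw [← mul_assoc]
      exact hle.trans (hmin' _ (mul_mem hg' hg))
    have h0 := hnorm g₀ hg₀ le_rfl
    intro g hg hg1
    by_contra hlt
    refine hg1 (hnorm g hg ?_)
    rw [h0, one_mul]
    omega

/-- This permits induction on length inside the Young subgroup. Without such a descent `g` would be
normal, as `1` is, and in the same coset. -/
lemma exists_not_asc_of_mem_youngOf {a : ℕ} {P : Set ℕ} (ha : a ∈ P) {g : W r} (hg : g ∈ youngOf P)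
    (hg1 : g ≠ 1) : ∃ k : Fin r, k.val ≠ 0 ∧ k.val ∉ P ∧ ¬ Asc k g := by
  by_contra! hcon
  refine hg1 (Normal.eq_one ha (d := 1) (youngOf_le a P hg) ⟨fun i _ => ?_, fun p k hpk _ => ?_⟩
    ⟨fun i _ => ?_, fun p k hpk hk => ?_⟩)
  · rw [window_one]; omega
  · rw [window_one, window_one]; omega
  · rw [mul_one, window_pos_iff]; exact (youngOf_spec hg).1 i
  · rw [mul_one, ← asc_succ hpk]; exact hcon k (by omega) hk

/-- Otherwise the sign change of `j` would be a nontrivial element of `d⁻¹ W_λ d ∩ W_μ`. -/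
lemma not_common_letter {a b : ℕ} {P Q : Set ℕ} {d : W r} (hd : d ∈ dist₀Of a P b Q) {j : Fin r}
    (hj : j.val < b) : a ≤ (d.right j).val := by
  by_contra! hlt
  have h1 := mul_flip d j
  have h2 : d⁻¹ * flip (d.right j) * d = flip j := by
    rw [mul_assoc, ← h1, inv_mul_cancel_left]
  have h3 := hd.2.2 _ (flip_mem_quasiParabolicOf P hlt)
    (by rw [h2]; exact flip_mem_quasiParabolicOf Q hj)
  rw [h2] at h3
  have h4 : (flip j).left j = (1 : W r).left j := by rw [h3]
  simp at h4

/-- Otherwise the transposition of `x` and `y` would be a nontrivial element of `d⁻¹ W_λ d ∩ W_μ`.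
-/
lemma not_common_block {a b : ℕ} {P Q : Set ℕ} {d : W r} (hd : d ∈ dist₀Of a P b Q) {x y : Fin r}
    (hxy : x ≠ y) (h : SameBlock P (d.right x) (d.right y))
    (hl : d.left (d.right x) = d.left (d.right y)) : ¬ SameBlock Q x y := by
  intro hQ
  have h1 := mul_swap d hl
  have h2 : d⁻¹ * ofPerm (Equiv.swap (d.right x) (d.right y)) * d = ofPerm (Equiv.swap x y) := by
    rw [mul_assoc, ← h1, inv_mul_cancel_left]
  have h3 := hd.2.2 _ (youngOf_le a P (swap_mem_youngOf h))
    (by rw [h2]; exact youngOf_le b Q (swap_mem_youngOf hQ))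
  rw [h2] at h3
  have h4 : (ofPerm (Equiv.swap x y)).right x = (1 : W r).right x := by rw [h3]
  simp at h4
  exact hxy h4.symm

lemma lt_of_not_sameBlock {Q : Set ℕ} {τ : Equiv.Perm (Fin r)}
    (hτ : ∀ i : Fin r, SameBlock Q i (τ i)) {x y : Fin r} (hxy : x < y) (h : ¬ SameBlock Q x y) :
    τ x < τ y := by
  unfold SameBlock at h
  push Not at h
  obtain ⟨m, hm, h⟩ := h
  have h1 := hτ x m hm
  have h2 := hτ y m hm
  rw [Fin.lt_def] at hxy ⊢
  omega

/-- The elements of `𝒟⁰` stay distinguished for one Young subgroup when multiplied by the other. -/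
lemma window_mul_young_lt {a b : ℕ} {P Q : Set ℕ} (ha : a ∈ P) {d g : W r}
    (hd : d ∈ dist₀Of a P b Q) (hg : g ∈ youngOf Q) {p k : Fin r} (hpk : p.val + 1 = k.val)
    (hk : k.val ∉ P) : window (d * g) p < window (d * g) k := by
  obtain ⟨hg1, hg2⟩ := youngOf_spec hg
  have hg3 : ∀ i : Fin r, SameBlock Q i (g.right⁻¹ i) := fun i => by
    have h1 := (hg2 (g.right⁻¹ i)).symm
    rwa [← Equiv.Perm.mul_apply, mul_inv_cancel, Equiv.Perm.one_apply] at h1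
  have hlt := ((mem_distOf_iff ha).1 hd.1).step p k hpk hk
  have hne : p ≠ k := by rintro rfl; omega
  rw [window_mul, window_mul, window_of_left_one (hg1 _), window_of_left_one (hg1 _)]
  simp only [window] at hlt
  set x := d.right⁻¹ p with hx
  set y := d.right⁻¹ k with hy
  have hdx : d.right x = p := by simp [hx]
  have hdy : d.right y = k := by simp [hy]
  have hxy : x ≠ y := fun h => hne (d.right⁻¹.injective h)
  have hnb : d.left p = d.left k → ¬ SameBlock Q x y := fun h =>
    not_common_block hd hxy (by rw [hdx, hdy]; exact sameBlock_of_not_mem hpk hk)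
      (by rw [hdx, hdy, h])
  -- Different signs decide the order by themselves. With equal signs the two letters lie in
  -- different blocks of `Q`, and `g` keeps the order of such letters.
  rcases Int.units_eq_one_or (d.left p) with h1 | h1 <;>
  rcases Int.units_eq_one_or (d.left k) with h2 | h2 <;> rw [h1, h2] at hlt hnb ⊢ <;>
  push_cast at hlt ⊢
  · have h3 := lt_of_not_sameBlock hg3 (x := x) (y := y) (by rw [Fin.lt_def]; omega) (hnb rfl)
    rw [Fin.lt_def] at h3; omega
  · omega
  · omega
  · have h3 := lt_of_not_sameBlock hg3 (x := y) (y := x) (by rw [Fin.lt_def]; omega)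
      (fun h => hnb rfl h.symm)
    rw [Fin.lt_def] at h3; omega

/-- A nontrivial `g' = w⁻¹ g w` is unsigned, by the disjointness hypothesis, so it moves some
letter. This gives two letters of equal sign in one block of `Q` whose places lie in one block of
`P`. Since `w` and `w⁻¹` increase on the blocks, the letter next to the lower of the two places has
the same sign and is adjacent to the letter at that place. -/
lemma exists_common_reflection {a b : ℕ} {P Q : Set ℕ} (ha : a ∈ P) (hb : b ∈ Q) {w : W r}
    (h1 : Normal a P w) (h2 : Normal b Q w⁻¹) (h0 : w ∉ dist₀Of a P b Q)
    (hdisj : ∀ j : Fin r, j.val < b → a ≤ (w.right j).val) :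
    ∃ k m : Fin r, k.val ≠ 0 ∧ k.val ∉ P ∧ m.val ≠ 0 ∧ m.val ∉ Q ∧ s k * w = w * s m := by
  have hex : ∃ g ∈ quasiParabolicOf a P, w⁻¹ * g * w ∈ quasiParabolicOf b Q ∧
      w⁻¹ * g * w ≠ 1 := by
    by_contra! hcon
    exact h0 ⟨(mem_distOf_iff ha).2 h1, (mem_distOf_iff hb).2 h2, hcon⟩
  obtain ⟨g, hg, hg', hne⟩ := hex
  obtain ⟨g', hgdef⟩ : ∃ g', g' = w⁻¹ * g * w := ⟨_, rfl⟩
  rw [← hgdef] at hg' hne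
  have hcomm : w * g' = g * w := by rw [hgdef]; group
  obtain ⟨hg1, hg2⟩ := quasiParabolicOf_spec ha hg
  obtain ⟨hg1', hg2'⟩ := quasiParabolicOf_spec hb hg'
  have hr : ∀ x, w.right (g'.right x) = g.right (w.right x) := fun x => by
    rw [← Equiv.Perm.mul_apply, ← Equiv.Perm.mul_apply, ← SemidirectProduct.mul_right, hcomm,
      SemidirectProduct.mul_right]
  have hl : ∀ x, w.left (w.right (g'.right x)) * g'.left (g'.right x) =
      g.left (w.right (g'.right x)) * w.left (w.right x) := fun x => by
    have h3 : (w * g').left (w.right (g'.right x)) = (g * w).left (w.right (g'.right x)) := by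
      rw [hcomm]
    have e1 : w.right⁻¹ (w.right (g'.right x)) = g'.right x := by simp
    have e2 : g.right⁻¹ (w.right (g'.right x)) = w.right x := by rw [hr]; simp
    rwa [left_mul, left_mul, e1, e2] at h3
  have hwb : ∀ j : Fin r, j.val < b → w.left (w.right j) = 1 := fun j hj => by
    have h3 := h2.pos j hj
    rw [window_inv] at h3
    rcases Int.units_eq_one_or (w.left (w.right j)) with h | h
    · exact h
    · rw [h] at h3; push_cast at h3; omega
  -- At each letter at least one of `g`, `g'` cannot change the sign. The sign of the other is then
  -- trivial by `w g' = g w`, because `w` has positive signs on the first `a` places and the first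
  -- `b` letters.
  have hsign : ∀ x, g'.left (g'.right x) = 1 ∧ g.left (w.right (g'.right x)) = 1 := fun x => by
    have h3 := hl x
    by_cases hx : b ≤ (g'.right x).val
    · have h4 := hg1' _ hx
      refine ⟨h4, ?_⟩
      by_cases hy : a ≤ (w.right (g'.right x)).val
      · exact hg1 _ hy
      · have h5 := window_pos_iff.1 (h1.pos (w.right (g'.right x)) (by omega))
        have h6 := hg2 (w.right x) a ha
        rw [← hr] at h6
        have h7 := window_pos_iff.1 (h1.pos (w.right x) (by omega))
        rw [h4, h5, h7] at h3
        simpa using h3.symm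
    · have h4 := hg1 _ (hdisj _ (not_le.1 hx))
      refine ⟨?_, h4⟩
      have h6 := hg2' x b hb
      rw [h4, hwb _ (not_le.1 hx), hwb x (by omega)] at h3
      simpa using h3
  have hl' : ∀ x, w.left (w.right (g'.right x)) = w.left (w.right x) := fun x => by
    have h3 := hl x
    rwa [(hsign x).1, (hsign x).2, one_mul, mul_one] at h3
  have hmov : ∃ x, g'.right x ≠ x := by
    by_contra! hcon
    refine hne (SemidirectProduct.ext (funext fun x => ?_) (Equiv.ext hcon))
    have := (hsign x).1
    rwa [hcon] at this
  obtain ⟨x, y, hP, hQ, hlxy, hlt⟩ : ∃ x y : Fin r, SameBlock P (w.right x) (w.right y) ∧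
      SameBlock Q x y ∧ w.left (w.right x) = w.left (w.right y) ∧ w.right x < w.right y := by
    obtain ⟨x, hx⟩ := hmov
    have hP : SameBlock P (w.right x) (w.right (g'.right x)) := by rw [hr]; exact hg2 _
    rcases lt_or_gt_of_ne (fun h => hx (w.right.injective h) :
      w.right (g'.right x) ≠ w.right x) with h | h
    · exact ⟨_, _, hP.symm, (hg2' x).symm, hl' x, h⟩
    · exact ⟨_, _, hP, hg2' x, (hl' x).symm, h⟩
  rw [Fin.lt_def] at hlt
  obtain ⟨k, hk⟩ : ∃ k : Fin r, (w.right x).val + 1 = k.val :=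
    ⟨⟨(w.right x).val + 1, by have := (w.right y).isLt; omega⟩, rfl⟩
  have hkP : SameBlock P (w.right x) k :=
    hP.of_between le_rfl (by omega) (by omega) (by omega)
  have hkP' := hkP.not_mem hk
  have hstep := h1.step (w.right x) k hk hkP'
  have hle : window w k ≤ window w (w.right y) := by
    rcases eq_or_ne k (w.right y) with h | h
    · rw [h]
    · refine (h1.window_lt (lt_of_le_of_ne (by rw [Fin.le_def]; omega) h) ?_).le
      exact hP.of_between (by omega) (by omega) (by omega) (by omega)
  set z := w.right⁻¹ k with hz
  have hwz : w.right z = k := by simp [hz]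
  have hwin : ∀ u, window w (w.right u) = (w.left (w.right u) : ℤ) * (u.val + 1) := fun u => by
    simp [window]
  rw [← hwz, hwin, hwin] at hstep hle
  rw [← hlxy] at hle
  have hinv : ∀ u v : Fin r, u < v → SameBlock Q u v → (w.left (w.right u) : ℤ) *
      ((w.right u).val + 1) < (w.left (w.right v) : ℤ) * ((w.right v).val + 1) := fun u v huv hb' => by
    have := h2.window_lt huv hb'
    rwa [window_inv, window_inv] at this
  -- A letter strictly between `x` and `z` would have a signed place strictly between two
  -- consecutive integers, since `w⁻¹` increases on the block of `Q`.
  have hfin : w.left (w.right z) = w.left (w.right x) ∧ SameBlock Q x z ∧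
      (x.val + 1 = z.val ∨ z.val + 1 = x.val) := by
    rcases Int.units_eq_one_or (w.left (w.right x)) with hx1 | hx1 <;>
    rcases Int.units_eq_one_or (w.left (w.right z)) with hz1 | hz1 <;>
    rw [hx1, hz1] at hstep hle <;> push_cast at hstep hle
    · refine ⟨by rw [hx1, hz1], hQ.of_between le_rfl (by omega) (by omega) (by omega), ?_⟩
      left
      by_contra hne'
      obtain ⟨u, hu⟩ : ∃ u : Fin r, x.val + 1 = u.val :=
        ⟨⟨x.val + 1, by have := z.isLt; omega⟩, rfl⟩
      have h3 := hinv x u (by rw [Fin.lt_def]; omega)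
        (hQ.of_between le_rfl (by omega) (by omega) (by omega))
      have h4 := hinv u z (by rw [Fin.lt_def]; omega)
        (hQ.of_between (by omega) (by omega) (by omega) (by omega))
      rw [hx1] at h3
      rw [hz1, hwz] at h4
      push_cast at h3 h4
      omega
    · omega
    · omega
    · refine ⟨by rw [hx1, hz1], (hQ.symm.of_between (by omega) (by omega) (by omega) (by omega)), ?_⟩
      right
      by_contra hne'
      obtain ⟨u, hu⟩ := exists_pred (k := x) (by omega)
      have h3 := hinv z u (by rw [Fin.lt_def]; omega)
        (hQ.symm.of_between (by omega) (by omega) (by omega) (by omega))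
      have h4 := hinv u x (by rw [Fin.lt_def]; omega)
        (hQ.symm.of_between (by omega) (by omega) (by omega) (by omega))
      rw [hx1] at h4
      rw [hz1, hwz] at h3
      push_cast at h3 h4
      omega
  obtain ⟨hf1, hf2, hf3⟩ := hfin
  have hsw := mul_swap w hf1.symm
  rw [hwz] at hsw
  rcases hf3 with h3 | h3
  · refine ⟨k, z, by omega, hkP', by omega, hf2.not_mem h3, ?_⟩
    rw [s_succ hk, s_succ h3, hsw]
  · refine ⟨k, x, by omega, hkP', by omega, hf2.symm.not_mem h3, ?_⟩
    rw [s_succ hk, s_succ h3, Equiv.swap_comm z x, hsw]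

end Blocks

end HeckeB

namespace HeckeB

/-! ### The regular representations, the basis `T_w` and the anti-automorphism -/

section RegularRepresentation

variable {R : Type*} [CommRing R] {r : ℕ} {q₀ q : Rˣ}

lemma leftMul_single_of_asc {i : Fin r} {w : W r} (h : Asc i w) :
    leftMul q₀ q i (Pi.single w 1) = Pi.single (s i * w) (1 : R) := by
  conv_lhs => rw [← Pi.basisFun_apply]
  rw [leftMul, Module.Basis.constr_basis]
  exact if_pos h

lemma leftMul_single_of_not_asc {i : Fin r} {w : W r} (h : ¬ Asc i w) :
    leftMul q₀ q i (Pi.single w 1) = (param q₀ q i - 1) • Pi.single w (1 : R) +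
      param q₀ q i • Pi.single (s i * w) (1 : R) := by
  conv_lhs => rw [← Pi.basisFun_apply]
  rw [leftMul, Module.Basis.constr_basis]
  exact if_neg h

lemma s_mul_ne (i : Fin r) (w : W r) : s i * w ≠ w := fun h => by
  have h1 := inversions_s_mul i w
  rw [h] at h1
  omega

/-- The multiplication rule in transposed form: it turns equations in the algebra into relations
between the coefficients at `z` and `s z`. -/
lemma leftMul_apply (i : Fin r) (v : W r → R) (z : W r) :
    leftMul q₀ q i v z = if Asc i z then param q₀ q i * v (s i * z)
      else v (s i * z) + (param q₀ q i - 1) * v z := by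
  let L : Module.End R (W r → R) :=
    { toFun := fun v z => if Asc i z then param q₀ q i * v (s i * z)
        else v (s i * z) + (param q₀ q i - 1) * v z
      map_add' := fun v v' => by
        funext z
        simp only [Pi.add_apply]
        split_ifs <;> ring
      map_smul' := fun c v => by
        funext z
        simp only [Pi.smul_apply, smul_eq_mul, RingHom.id_apply]
        split_ifs <;> ring }
  have h : leftMul q₀ q i = L := by
    refine (Pi.basisFun R (W r)).ext fun w => ?_
    rw [Pi.basisFun_apply]
    funext z
    have hL : L (Pi.single w 1) z = if Asc i z then param q₀ q i * Pi.single (M := fun _ => R) w 1 (s i * z)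
        else Pi.single (M := fun _ => R) w 1 (s i * z) + (param q₀ q i - 1) * Pi.single (M := fun _ => R) w 1 z := rfl
    rw [hL]
    by_cases hz : z = s i * w
    · subst hz
      have h1 := s_mul_ne i w
      by_cases hw : Asc i w
      · rw [leftMul_single_of_asc hw, if_neg (by rw [asc_s_mul]; exact not_not.2 hw)]
        simp [h1]
      · rw [leftMul_single_of_not_asc hw, if_pos (by rw [asc_s_mul]; exact hw)]
        simp [h1]
    · have h1 : s i * z ≠ w := fun h => hz (by rw [← h, s_mul_s_mul])
      by_cases hw : Asc i w
      · rw [leftMul_single_of_asc hw]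
        by_cases hzw : z = w
        · subst hzw
          simp [h1, hw, hz]
        · simp [h1, hzw, hz]
      · rw [leftMul_single_of_not_asc hw]
        by_cases hzw : z = w
        · subst hzw
          simp [h1, hw, hz]
        · simp [h1, hzw, hz]
  rw [h]
  rfl

/-- `T_w ↦ T_{w⁻¹}` on the free module. -/
def invert : (W r → R) ≃ₗ[R] (W r → R) := LinearEquiv.funCongrLeft R R (Equiv.inv (W r))

@[simp] lemma invert_apply (v : W r → R) (w : W r) : invert v w = v w⁻¹ := rfl

@[simp] lemma invert_invert (v : W r → R) : invert (invert v) = v := by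
  funext w; simp

lemma invert_single (w : W r) : invert (Pi.single w (1 : R)) = Pi.single w⁻¹ 1 := by
  funext z
  simp [Pi.single_apply, inv_eq_iff_eq_inv]

/-- Right multiplication by `T_{s_i}` on the free module. -/
def rightMul (q₀ q : Rˣ) (i : Fin r) : Module.End R (W r → R) :=
  invert.toLinearMap ∘ₗ leftMul q₀ q i ∘ₗ invert.toLinearMap

lemma rightMul_eq (i : Fin r) (v : W r → R) :
    rightMul q₀ q i v = invert (leftMul q₀ q i (invert v)) := rfl

lemma rightMul_apply (i : Fin r) (v : W r → R) (z : W r) :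
    rightMul q₀ q i v z = if Asc i z⁻¹ then param q₀ q i * v (z * s i)
      else v (z * s i) + (param q₀ q i - 1) * v z := by
  rw [rightMul_eq, invert_apply, leftMul_apply]
  simp [s_inv]

/-- The product of the signs. -/
def signProd (w : W r) : ℤˣ := ∏ i, w.left i

lemma signProd_mul (g w : W r) : signProd (g * w) = signProd g * signProd w := by
  simp only [signProd, left_mul, Finset.prod_mul_distrib]
  congr 1
  exact Equiv.prod_comp g.right⁻¹ w.left

lemma signProd_s (i : Fin r) : signProd (s i) = if i.val = 0 then -1 else 1 := by
  split_ifs with h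
  · rw [s_zero h]
    simp [signProd, flip, Finset.prod_pi_mulSingle']
  · obtain ⟨p, hp⟩ := exists_pred h
    rw [s_succ hp]
    simp [signProd]

/-- The product of the signs is a character of `W` that separates `s_0` from the other simple
reflections. -/
lemma param_eq_of_conj {i j : Fin r} {z : W r} (h : s i * z = z * s j) :
    param q₀ q i = param q₀ q j := by
  have h1 : signProd (s i) = signProd (s j) := by
    have h2 := congrArg signProd h
    rw [signProd_mul, signProd_mul, mul_comm] at h2
    exact mul_left_cancel h2
  rw [signProd_s, signProd_s] at h1
  unfold param
  split_ifs at h1 ⊢ <;> first | rfl | exact absurd h1 (by decide)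

/-- If `s_i z ≠ z s_j`, the exchange property shows that multiplication on one side does not affect
descents on the other. If they are equal, only `z` and `s_i z` are involved and the parameters
agree. -/
lemma leftMul_rightMul_comm (i j : Fin r) (v : W r → R) :
    leftMul q₀ q i (rightMul q₀ q j v) = rightMul q₀ q j (leftMul q₀ q i v) := by
  funext z
  simp only [leftMul_apply, rightMul_apply]
  by_cases h : s i * z = z * s j
  · have hA : Asc j z⁻¹ ↔ Asc i z := by rw [asc_inv, Asc, h]
    have hC : Asc i (z * s j) ↔ ¬ Asc i z := by rw [← h, asc_s_mul]
    have hD : Asc j (s i * z)⁻¹ ↔ ¬ Asc i z := by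
      rw [asc_inv, ← asc_s_mul, Asc, s_mul_s_mul, h, mul_s_mul_s]
    have h2 : s i * (z * s j) = z := by rw [← h, s_mul_s_mul]
    have h3 : s i * z * s j = z := by rw [h, mul_s_mul_s]
    rw [hA, hC, hD, h2, h3, param_eq_of_conj (q₀ := q₀) (q := q) h]
    by_cases hz : Asc i z
    · simp only [hz, not_true_eq_false, if_true, if_false, ← h]
    · simp only [hz, not_false_eq_true, if_true, if_false, ← h]
  · have hA : Asc i (z * s j) ↔ Asc i z := by
      constructor
      · intro h1
        by_contra h2
        have h3 := s_mul_eq_mul_s (i := i) (j := j) (w := z * s j) h1 (by rwa [mul_s_mul_s])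
        rw [mul_s_mul_s] at h3
        exact h (by rw [← h3, s_mul_s_mul, h3])
      · intro h1
        by_contra h2
        exact h (s_mul_eq_mul_s h1 h2)
    have hB : Asc j (s i * z)⁻¹ ↔ Asc j z⁻¹ := by
      rw [mul_inv_rev, s_inv]
      constructor
      · intro h1
        by_contra h2
        have h3 := s_mul_eq_mul_s (i := j) (j := i) (w := z⁻¹ * s i) h1 (by rwa [mul_s_mul_s])
        rw [mul_s_mul_s] at h3
        have h4 := congrArg (·⁻¹) h3
        simp only [mul_inv_rev, s_inv, inv_inv] at h4
        exact h (by rw [← mul_s_mul_s j (s i * z), h4])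
      · intro h1
        by_contra h2
        have h3 := s_mul_eq_mul_s h1 h2
        have h4 := congrArg (·⁻¹) h3
        simp only [mul_inv_rev, s_inv, inv_inv] at h4
        exact h h4.symm
    rw [hA, hB, mul_assoc]
    split_ifs <;> ring

/-- The coordinates of an element of the Hecke algebra. -/
def vec (h : Hecke R r q₀ q) : W r → R := h.1 (Pi.single 1 1)

lemma hecke_rightMul_comm (h : Hecke R r q₀ q) (j : Fin r) (v : W r → R) :
    h.1 (rightMul q₀ q j v) = rightMul q₀ q j (h.1 v) := by
  obtain ⟨x, hx⟩ := h
  change x (rightMul q₀ q j v) = rightMul q₀ q j (x v)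
  induction hx using Algebra.adjoin_induction generalizing v with
  | mem x hx =>
    obtain ⟨i, rfl⟩ := hx
    exact leftMul_rightMul_comm i j v
  | algebraMap c => simp
  | add x y _ _ ihx ihy => rw [LinearMap.add_apply, ihx, ihy, LinearMap.add_apply, map_add]
  | mul x y _ _ ihx ihy => rw [Module.End.mul_apply, ihy, ihx, Module.End.mul_apply]

lemma rightMul_single_of_lt {i : Fin r} {w : W r} (h : length w < length (w * s i)) :
    rightMul q₀ q i (Pi.single w 1) = Pi.single (w * s i) (1 : R) := by
  rw [rightMul_eq, invert_single, leftMul_single_of_asc (asc_inv.2 h), invert_single, mul_inv_rev,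
    inv_inv, s_inv]

/-- The elements of `H'` commute with the right multiplications, and these generate every `T_w` from
`T_1`. Identities in `H'` can therefore be tested on coefficients. -/
lemma vec_injective : Function.Injective (vec : Hecke R r q₀ q → W r → R) := by
  intro h h' heq
  have key : ∀ n : ℕ, ∀ w : W r, length w = n → h.1 (Pi.single w 1) = h'.1 (Pi.single w 1) := by
    intro n
    induction n with
    | zero =>
      intro w hw
      by_cases h1 : w = 1
      · subst h1; exact heq
      · obtain ⟨i, hi⟩ := exists_not_asc h1
        have := length_of_not_asc hi
        omega
    | succ n ih =>
      intro w hw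
      have h1 : w⁻¹ ≠ 1 := fun h1 => by
        rw [inv_eq_one] at h1; subst h1; simp at hw
      obtain ⟨i, hi⟩ := exists_not_asc h1
      have h2 := length_of_not_asc hi
      rw [length_inv, ← length_inv (s i * w⁻¹), mul_inv_rev, s_inv, inv_inv] at h2
      have h3 : Pi.single w (1 : R) = rightMul q₀ q i (Pi.single (w * s i) 1) := by
        rw [rightMul_single_of_lt (by rw [mul_s_mul_s]; omega), mul_s_mul_s]
      rw [h3, hecke_rightMul_comm, hecke_rightMul_comm, ih _ (by omega)]
  refine Subtype.ext ((Pi.basisFun R (W r)).ext fun w => ?_)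
  rw [Pi.basisFun_apply]
  exact key _ w rfl

lemma vec_add (h h' : Hecke R r q₀ q) : vec (h + h') = vec h + vec h' := rfl

lemma vec_smul (c : R) (h : Hecke R r q₀ q) : vec (c • h) = c • vec h := rfl

lemma vec_Tgen_mul (i : Fin r) (h : Hecke R r q₀ q) :
    vec (Tgen q₀ q i * h) = leftMul q₀ q i (vec h) := rfl

lemma vec_one : vec (1 : Hecke R r q₀ q) = Pi.single 1 1 := rfl

lemma vec_Tgen (i : Fin r) : vec (Tgen q₀ q i) = Pi.single (s i) 1 := by
  have h : Asc i 1 := by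
    by_contra h
    have := length_of_not_asc h
    simp at this
  have := leftMul_single_of_asc (q₀ := q₀) (q := q) h
  rwa [mul_one] at this

lemma vec_mul_Tgen (i : Fin r) (h : Hecke R r q₀ q) :
    vec (h * Tgen q₀ q i) = rightMul q₀ q i (vec h) := by
  have h1 : vec (h * Tgen q₀ q i) = h.1 (vec (Tgen q₀ q i)) := rfl
  have h2 : length (1 : W r) < length (1 * s i) := by
    rw [one_mul, length_one, Nat.pos_iff_ne_zero]
    intro h3
    have h4 := inversions_s_mul i (1 : W r)
    rw [← length_eq_inversions, ← length_eq_inversions, mul_one, h3, length_one] at h4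
    omega
  have h3 := rightMul_single_of_lt (q₀ := q₀) (q := q) h2
  rw [one_mul] at h3
  rw [h1, vec_Tgen, ← h3, hecke_rightMul_comm]
  rfl

lemma vec_prod_of_reduced (l : List (Fin r)) (hl : length (l.map s).prod = l.length) :
    vec ((l.map (Tgen q₀ q)).prod) = Pi.single (l.map s).prod (1 : R) := by
  induction l with
  | nil => exact vec_one
  | cons i l ih =>
    simp only [List.map_cons, List.prod_cons, List.length_cons] at hl ⊢
    have h1 := length_s_mul_le i (l.map s).prod
    have h2 := length_le_of_isWord (w := (l.map s).prod) (l := l) rfl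
    rw [vec_Tgen_mul, ih (by omega), leftMul_single_of_asc (by rw [Asc]; omega)]

@[simp] lemma vec_T (w : W r) : vec (T q₀ q w) = Pi.single w (1 : R) := by
  obtain ⟨h1, h2⟩ := reducedWord_spec w
  have h3 : ((reducedWord w).map s).prod = w := h1
  rw [T, vec_prod_of_reduced _ (by rw [h3, h2]), h3]

/-- The Hecke algebra is free with basis `T_w`. -/
def vecEquiv : Hecke R r q₀ q ≃ₗ[R] (W r → R) :=
  LinearEquiv.ofBijective { toFun := vec, map_add' := vec_add, map_smul' := vec_smul }
    ⟨vec_injective, fun v => ⟨∑ w, v w • T q₀ q w, by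
      rw [map_sum]
      simp only [LinearMap.map_smul]
      funext z
      simp [Finset.sum_apply, Pi.single_apply]⟩⟩

@[simp] lemma vecEquiv_apply (h : Hecke R r q₀ q) : vecEquiv h = vec h := rfl

/-- The anti-automorphism `T_w ↦ T_{w⁻¹}`. -/
def rev : Hecke R r q₀ q ≃ₗ[R] Hecke R r q₀ q := vecEquiv.trans (invert.trans vecEquiv.symm)

lemma vec_rev (h : Hecke R r q₀ q) : vec (rev h) = invert (vec h) := by
  rw [← vecEquiv_apply (rev h), rev]
  simp

@[simp] lemma rev_rev (h : Hecke R r q₀ q) : rev (rev h) = h :=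
  vec_injective (by rw [vec_rev, vec_rev, invert_invert])

@[simp] lemma rev_T (w : W r) : rev (T q₀ q w) = T q₀ q w⁻¹ :=
  vec_injective (by rw [vec_rev, vec_T, vec_T, invert_single])

@[simp] lemma rev_Tgen (i : Fin r) : rev (Tgen q₀ q i) = Tgen q₀ q i :=
  vec_injective (by rw [vec_rev, vec_Tgen, invert_single, s_inv])

@[simp] lemma rev_one : rev (1 : Hecke R r q₀ q) = 1 :=
  vec_injective (by rw [vec_rev, vec_one, invert_single, inv_one])

lemma rev_mul_Tgen (h : Hecke R r q₀ q) (i : Fin r) :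
    rev (h * Tgen q₀ q i) = Tgen q₀ q i * rev h :=
  vec_injective (by
    rw [vec_rev, vec_mul_Tgen, vec_Tgen_mul, vec_rev, rightMul_eq, invert_invert])

lemma eq_sum_T (h : Hecke R r q₀ q) : h = ∑ w, vec h w • T q₀ q w := by
  apply vecEquiv.injective
  rw [map_sum]
  funext z
  simp [Finset.sum_apply, Pi.single_apply]

lemma rev_mul_prod (h : Hecke R r q₀ q) (l : List (Fin r)) :
    rev (h * (l.map (Tgen q₀ q)).prod) = rev ((l.map (Tgen q₀ q)).prod) * rev h := by
  induction l generalizing h with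
  | nil => simp
  | cons i l ih =>
    rw [List.map_cons, List.prod_cons, ← mul_assoc, ih, rev_mul_Tgen, ih (Tgen q₀ q i), rev_Tgen,
      mul_assoc]

lemma rev_mul (h h' : Hecke R r q₀ q) : rev (h * h') = rev h' * rev h := by
  rw [eq_sum_T h', Finset.mul_sum, map_sum, map_sum, Finset.sum_mul]
  refine Finset.sum_congr rfl fun w _ => ?_
  rw [mul_smul_comm, map_smul, map_smul, smul_mul_assoc, T, rev_mul_prod]

lemma Tgen_mul_T {i : Fin r} {w : W r} (h : Asc i w) :
    Tgen q₀ q i * T q₀ q w = T (R := R) q₀ q (s i * w) :=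
  vec_injective (by rw [vec_Tgen_mul, vec_T, leftMul_single_of_asc h, vec_T])

lemma T_mul_Tgen {i : Fin r} {w : W r} (h : Asc i w⁻¹) :
    T q₀ q w * Tgen q₀ q i = T (R := R) q₀ q (w * s i) :=
  vec_injective (by rw [vec_mul_Tgen, vec_T, rightMul_single_of_lt (asc_inv.1 h), vec_T])

lemma T_one : T (R := R) q₀ q (1 : W r) = 1 := vec_injective (by rw [vec_T, vec_one])

lemma T_s (i : Fin r) : T (R := R) q₀ q (s i) = Tgen q₀ q i :=
  vec_injective (by rw [vec_T, vec_Tgen])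

lemma Tgen_mul_Tgen (i : Fin r) : Tgen q₀ q i * Tgen q₀ q i =
    (param q₀ q i - 1) • Tgen q₀ q i + param q₀ q i • (1 : Hecke R r q₀ q) := by
  refine vec_injective ?_
  have h : ¬ Asc i (s i) := by
    have h1 : Asc i (s i * 1) ↔ ¬ Asc i 1 := asc_s_mul
    rw [mul_one] at h1
    rw [h1, not_not, Asc, length_one, Nat.pos_iff_ne_zero, mul_one]
    intro h2
    have h4 := inversions_s_mul i (1 : W r)
    rw [← length_eq_inversions, ← length_eq_inversions, mul_one, h2, length_one] at h4
    omega
  rw [vec_Tgen_mul, vec_Tgen, leftMul_single_of_not_asc h, vec_add, vec_smul, vec_smul, vec_Tgen,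
    vec_one, s_mul_self]

lemma T_commute {i : Fin r} {w : W r} (h : Asc i w) (hc : s i * w = w * s i) :
    Commute (Tgen (R := R) q₀ q i) (T q₀ q w) := by
  have h1 : Asc i w⁻¹ := by rw [asc_inv, ← hc]; exact h
  rw [Commute, SemiconjBy, Tgen_mul_T h, T_mul_Tgen h1, hc]

end RegularRepresentation

end HeckeB

namespace HeckeB

/-! ### The commuting elements `T_{t_i}` -/

section Murphy

variable {R : Type*} [CommRing R] {r : ℕ} {q₀ q : Rˣ}

lemma param_zero {i : Fin r} (h : i.val = 0) : param (R := R) q₀ q i = q₀ := if_pos h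

lemma param_succ {i : Fin r} (h : i.val ≠ 0) : param (R := R) q₀ q i = q := if_neg h

lemma window_s_left {p k : Fin r} (hp : p.val + 1 = k.val) : window (s k) p = k.val + 1 := by
  rw [← mul_one (s k), s_succ hp, window_swap_mul, window_one, Equiv.swap_apply_left]

lemma window_s_right {p k : Fin r} (hp : p.val + 1 = k.val) : window (s k) k = p.val + 1 := by
  rw [← mul_one (s k), s_succ hp, window_swap_mul, window_one, Equiv.swap_apply_right]

lemma T_flip_zero {i : Fin r} (h : i.val = 0) : T (R := R) q₀ q (flip i) = Tgen q₀ q i := by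
  rw [← s_zero h, T_s]

/-- Both multiplications in `t_k = s_k t_p s_k` increase the length. -/
lemma T_flip_succ {p k : Fin r} (hp : p.val + 1 = k.val) :
    T (R := R) q₀ q (flip k) = Tgen q₀ q k * T q₀ q (flip p) * Tgen q₀ q k := by
  have hne : k ≠ p := by rintro rfl; omega
  have h1 : Asc k (flip p) := by
    rw [asc_succ hp, window_flip_self, window_flip_ne hne]; omega
  have h2 : Asc k (s k * flip p)⁻¹ := by
    rw [mul_inv_rev, s_inv, flip_inv, asc_succ hp, window_flip_mul_self, window_flip_mul_ne _ hne,
      window_s_left hp, window_s_right hp]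
    omega
  rw [Tgen_mul_T h1, T_mul_Tgen h2, s_mul_flip hp, mul_s_mul_s]

lemma flip_comm (i j : Fin r) : flip i * flip j = flip j * flip i := by
  rw [mul_flip]; rfl

lemma Tgen_commute_T_flip {p k j : Fin r} (hp : p.val + 1 = k.val) (h1 : j ≠ p) (h2 : j ≠ k) :
    Commute (Tgen (R := R) q₀ q k) (T q₀ q (flip j)) := by
  refine T_commute ?_ ?_
  · rw [asc_succ hp, window_flip_ne h1.symm, window_flip_ne h2.symm]; omega
  · rw [s_succ hp, mul_flip, ofPerm_right, Equiv.swap_apply_of_ne_of_ne h1 h2]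

lemma Tgen_zero_commute_T_flip {i j : Fin r} (hi : i.val = 0) (h : j ≠ i) :
    Commute (Tgen (R := R) q₀ q i) (T q₀ q (flip j)) := by
  refine T_commute ?_ ?_
  · rw [asc_zero hi, window_flip_ne h.symm]; omega
  · rw [s_zero hi, flip_comm]

/-- For `i < j`, `T_{t_i}` is a product of generators that each commute with `T_{t_j}`. -/
lemma T_flip_commute_of_lt (n : ℕ) : ∀ {i j : Fin r}, i.val = n → i < j →
    Commute (T (R := R) q₀ q (flip i)) (T q₀ q (flip j)) := by
  induction n with
  | zero =>
    intro i j hi hij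
    rw [T_flip_zero hi]
    exact Tgen_zero_commute_T_flip hi (ne_of_gt hij)
  | succ n ih =>
    intro i j hi hij
    obtain ⟨p, hp⟩ := exists_pred (k := i) (by omega)
    have hpj : p < j := by rw [Fin.lt_def] at *; omega
    have h1 := Tgen_commute_T_flip (R := R) (q₀ := q₀) (q := q) hp (ne_of_gt hpj) (ne_of_gt hij)
    rw [T_flip_succ hp]
    exact (h1.mul_left (ih (by omega) hpj)).mul_left h1

lemma T_flip_commute (i j : Fin r) : Commute (T (R := R) q₀ q (flip i)) (T q₀ q (flip j)) := by
  rcases lt_trichotomy i j with h | h | h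
  · exact T_flip_commute_of_lt _ rfl h
  · rw [h]
  · exact (T_flip_commute_of_lt _ rfl h).symm

end Murphy

/-- The parameters of the two families `x_λ` and `y_λ`: the products `∏ (α q^i + β T_{t_{i+1}})`,
the sums `∑ c^{ℓ(w)} T_w`, and the eigenvalues `κ₀` and `κ` of `T_{s_0}` and `T_{s_i}`. -/
structure EigenData {R : Type*} [CommRing R] (q₀ q : Rˣ) where
  α : Rˣ
  β : R
  c : R
  κ₀ : R
  κ : R
  -- These relations say that `α + β T_{s_0}` and `1 + c T_{s_i}` are eigenvectors of `T_{s_0}` and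
  -- `T_{s_i}`, with eigenvalues `κ₀` and `κ`.
  mul_q₀ : β * q₀ = κ₀ * α
  add_q₀ : α + β * (q₀ - 1) = κ₀ * β
  mul_q : q * c = κ
  add_q : 1 + (q - 1) * c = κ * c

/-! ### Eigenvector relations, for `x_λ` and `y_λ` at the same time -/

namespace EigenData

variable {R : Type*} [CommRing R] {r : ℕ} {q₀ q : Rˣ} (D : EigenData q₀ q)

/-- The data of `x_λ`. -/
def index (q₀ q : Rˣ) : EigenData q₀ q where
  α := 1
  β := 1
  c := 1
  κ₀ := q₀
  κ := q
  mul_q₀ := by simp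
  add_q₀ := by simp
  mul_q := by simp
  add_q := by ring

/-- The data of `y_λ`. -/
def sign (q₀ q : Rˣ) : EigenData q₀ q where
  α := q₀
  β := -1
  c := ((-q)⁻¹ : Rˣ)
  κ₀ := -1
  κ := -1
  mul_q₀ := by ring
  add_q₀ := by ring
  mul_q := by simp
  add_q := by
    have h : (q : R) * ((-q)⁻¹ : Rˣ) = -1 := by simp
    linear_combination h

/-- The factor `α q^i + β T_{t_{i+1}}`. -/
def factor (i : Fin r) : Hecke R r q₀ q :=
  ((D.α : R) * (q : R) ^ i.val) • (1 : Hecke R r q₀ q) + D.β • T q₀ q (flip i)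

/-- The common generalization of `π_a` and `π_a⁻`. -/
def pi (r a : ℕ) : Hecke R r q₀ q := (((List.finRange r).take a).map D.factor).prod

lemma pi_zero : D.pi r 0 = 1 := by simp [pi]

lemma pi_succ {a : ℕ} (h : a < r) : D.pi r (a + 1) = D.pi r a * D.factor ⟨a, h⟩ := by
  have h1 : (List.finRange r).take (a + 1) = (List.finRange r).take a ++ [⟨a, h⟩] := by
    rw [List.take_succ_eq_append_getElem (by simpa using h)]
    simp
  rw [pi, h1, List.map_append, List.prod_append, pi]
  simp

lemma commute_factor {x : Hecke R r q₀ q} {i : Fin r} (h : Commute x (T q₀ q (flip i))) :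
    Commute x (D.factor i) :=
  ((Commute.one_right x).smul_right _).add_right (h.smul_right _)

/-- Although `T` commutes with neither factor, it commutes with `X Y` and, by the quadratic
relation, with `Y + q X`. The ratio `q` of the constant terms makes the product a combination of `1`
and these two. -/
lemma commute_factor_pair {T X Y : Hecke R r q₀ q} (hT : T * T = ((q : R) - 1) • T + (q : R) • 1)
    (hY : Y = T * X * T) (hXY : Commute X Y) (c b : R) :
    Commute T ((c • 1 + b • X) * ((c * q) • 1 + b • Y)) := by
  have h1 : Commute T (Y + (q : R) • X) := by
    rw [Commute, SemiconjBy, hY]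
    have e1 : T * (T * X * T) = T * T * X * T := by simp only [mul_assoc]
    have e2 : T * X * T * T = T * X * (T * T) := by simp only [mul_assoc]
    rw [mul_add, add_mul, e1, e2, hT]
    simp only [add_mul, mul_add, smul_mul_assoc, mul_smul_comm, one_mul, mul_one]
    abel
  have h2 : Commute T (X * Y) := by
    rw [Commute, SemiconjBy]
    have e1 : T * (X * Y) = Y * X * T := by rw [hY]; simp only [mul_assoc]
    rw [e1, hXY.eq]
  have h3 : (c • (1 : Hecke R r q₀ q) + b • X) * ((c * q) • 1 + b • Y) =
      (c * (c * q)) • 1 + (c * b) • (Y + (q : R) • X) + (b * b) • (X * Y) := by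
    simp only [add_mul, mul_add, smul_mul_assoc, mul_smul_comm, one_mul, mul_one, smul_add,
      smul_smul]
    rw [show c * (q : R) * c = c * (c * q) by ring, show c * (q : R) * b = c * b * q by ring,
      show b * c = c * b by ring]
    abel
  rw [h3]
  exact ((((Commute.one_right T).smul_right _)).add_right (h1.smul_right _)).add_right
    (h2.smul_right _)

lemma Tgen_commute_pi {k : Fin r} (hk : k.val ≠ 0) : ∀ a ≤ r, k.val ≠ a →
    Commute (Tgen q₀ q k) (D.pi r a) := by
  obtain ⟨p, hp⟩ := exists_pred hk
  intro a
  induction a using Nat.strong_induction_on with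
  | _ a ih =>
    intro ha hka
    rcases a with _ | a
    · rw [pi_zero]; exact Commute.one_right _
    · by_cases h : k.val = a
      · have hk' : (⟨a, ha⟩ : Fin r) = k := Fin.ext h.symm
        obtain rfl : a = p.val + 1 := by omega
        rw [pi_succ D ha, pi_succ D (a := p.val) p.isLt, mul_assoc, hk']
        refine (ih p.val (by omega) (by omega) (by omega)).mul_right ?_
        have h1 := Tgen_mul_Tgen (R := R) (q₀ := q₀) (q := q) k
        rw [param_succ hk] at h1
        have h2 := commute_factor_pair h1 (T_flip_succ (R := R) (q₀ := q₀) (q := q) hp)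
          (T_flip_commute p k) (D.α * q ^ p.val) D.β
        rw [mul_assoc, ← pow_succ, hp] at h2
        exact h2
      · rw [pi_succ D ha]
        refine (ih a (by omega) (by omega) h).mul_right (D.commute_factor ?_)
        refine Tgen_commute_T_flip hp ?_ ?_
        · rintro rfl; simp at hp; omega
        · rintro rfl; simp at h

lemma Tgen_zero_mul_pi {i : Fin r} (hi : i.val = 0) : ∀ a ≤ r, 0 < a →
    Tgen q₀ q i * D.pi r a = D.κ₀ • D.pi r a := by
  intro a
  induction a with
  | zero => intro _ h; omega
  | succ a ih =>
    intro ha _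
    rw [pi_succ D ha]
    by_cases h0 : a = 0
    · subst h0
      have h1 : (⟨0, ha⟩ : Fin r) = i := Fin.ext hi.symm
      have h2 := Tgen_mul_Tgen (R := R) (q₀ := q₀) (q := q) i
      rw [param_zero hi] at h2
      rw [pi_zero, one_mul, h1, factor, T_flip_zero hi, hi, pow_zero, mul_one, mul_add,
        mul_smul_comm, mul_smul_comm, h2, mul_one, smul_add, smul_add, smul_smul, smul_smul,
        smul_smul, smul_smul, ← D.mul_q₀, ← D.add_q₀, add_smul]
      abel
    · rw [← mul_assoc, ih (by omega) (by omega), smul_mul_assoc]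

lemma T_flip_commute_pi (i : Fin r) : ∀ a ≤ r, Commute (T q₀ q (flip i)) (D.pi r a) := by
  intro a
  induction a with
  | zero => intro _; rw [pi_zero]; exact Commute.one_right _
  | succ a ih =>
    intro ha
    rw [pi_succ D ha]
    exact (ih (by omega)).mul_right (D.commute_factor (T_flip_commute _ _))

lemma factor_commute_pi (i : Fin r) {a : ℕ} (ha : a ≤ r) : Commute (D.factor i) (D.pi r a) :=
  ((Commute.one_left _).smul_left _).add_left ((D.T_flip_commute_pi i a ha).smul_left _)

lemma rev_factor (i : Fin r) : rev (D.factor i) = D.factor i := by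
  rw [factor, map_add, map_smul, map_smul, rev_one, rev_T, flip_inv]

lemma rev_pi : ∀ a ≤ r, rev (D.pi r a) = D.pi r a := by
  intro a
  induction a with
  | zero => intro _; rw [pi_zero, rev_one]
  | succ a ih =>
    intro ha
    rw [pi_succ D ha, rev_mul, rev_factor, ih (by omega),
      (D.factor_commute_pi _ (by omega)).eq]

/-- The sum `∑ c^{ℓ(w)} T_w` over a Young subgroup. -/
def youngSum (r : ℕ) (P : Set ℕ) : Hecke R r q₀ q :=
  ∑ w ∈ Finset.univ.filter (fun w => w ∈ youngOf P), D.c ^ length w • T q₀ q w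

lemma vec_youngSum (P : Set ℕ) (z : W r) :
    vec (D.youngSum r P) z = if z ∈ youngOf P then D.c ^ length z else 0 := by
  rw [← vecEquiv_apply, youngSum, map_sum]
  simp [Finset.sum_apply, Pi.single_apply]

lemma rev_youngSum (P : Set ℕ) : rev (D.youngSum r P) = D.youngSum r P := by
  refine vec_injective (funext fun z => ?_)
  rw [vec_rev, invert_apply, vec_youngSum, vec_youngSum, inv_mem_iff, length_inv]

lemma Tgen_mul_youngSum {P : Set ℕ} {k : Fin r} (h0 : k.val ≠ 0) (hk : k.val ∉ P) :
    Tgen q₀ q k * D.youngSum r P = D.κ • D.youngSum r P := by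
  refine vec_injective (funext fun z => ?_)
  have hs := s_mem_youngOf h0 hk
  rw [vec_Tgen_mul, leftMul_apply, vec_smul, Pi.smul_apply, smul_eq_mul, vec_youngSum,
    vec_youngSum, Subgroup.mul_mem_cancel_left _ hs, param_succ h0, ← D.mul_q]
  by_cases hz : z ∈ youngOf P
  · simp only [hz, if_true]
    split_ifs with h
    · rw [h.length_eq, pow_succ]; ring
    · rw [← length_of_not_asc h, pow_succ]
      linear_combination D.c ^ length (s k * z) * (D.add_q - D.c * D.mul_q)
  · simp [hz]

lemma T_young_commute_pi {a : ℕ} {P : Set ℕ} (ha : a ∈ P) (har : a ≤ r) (n : ℕ) : ∀ {w : W r},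
    length w = n → w ∈ youngOf P → Commute (T q₀ q w) (D.pi r a) := by
  induction n with
  | zero =>
    intro w hw hP
    by_cases h1 : w = 1
    · rw [h1, T_one]; exact Commute.one_left _
    · obtain ⟨k, _, _, hk⟩ := exists_not_asc_of_mem_youngOf ha hP h1
      have := length_of_not_asc hk
      omega
  | succ n ih =>
    intro w hw hP
    by_cases h1 : w = 1
    · rw [h1, T_one]; exact Commute.one_left _
    · obtain ⟨k, h0, hkP, hk⟩ := exists_not_asc_of_mem_youngOf ha hP h1
      have h2 := length_of_not_asc hk
      have h3 := Tgen_mul_T (R := R) (q₀ := q₀) (q := q) (asc_s_mul.2 hk)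
      rw [s_mul_s_mul] at h3
      rw [← h3]
      exact (D.Tgen_commute_pi h0 a har (fun h => hkP (h ▸ ha))).mul_left
        (ih (by omega) (mul_mem (s_mem_youngOf h0 hkP) hP))

lemma youngSum_commute_pi (D' : EigenData q₀ q) {a : ℕ} {P : Set ℕ} (ha : a ∈ P) (har : a ≤ r) :
    Commute (D'.youngSum r P) (D.pi r a) := by
  refine Commute.sum_left _ _ _ fun w hw => ?_
  exact (D.T_young_commute_pi ha har _ rfl (Finset.mem_filter.1 hw).2).smul_left _

/-- The common generalization of `x_λ` and `y_λ`. -/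
def elem (r a : ℕ) (P : Set ℕ) : Hecke R r q₀ q := D.pi r a * D.youngSum r P

lemma rev_elem {a : ℕ} {P : Set ℕ} (ha : a ∈ P) (har : a ≤ r) :
    rev (D.elem r a P) = D.elem r a P := by
  rw [elem, rev_mul, rev_youngSum, rev_pi D a har, (D.youngSum_commute_pi D ha har).eq]

lemma Tgen_mul_elem {a : ℕ} {P : Set ℕ} (ha : a ∈ P) (har : a ≤ r) {k : Fin r} (h0 : k.val ≠ 0)
    (hk : k.val ∉ P) : Tgen q₀ q k * D.elem r a P = D.κ • D.elem r a P := by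
  rw [elem, ← mul_assoc, (D.Tgen_commute_pi h0 a har (fun h => hk (h ▸ ha))).eq, mul_assoc,
    D.Tgen_mul_youngSum h0 hk, mul_smul_comm]

end EigenData

end HeckeB

namespace HeckeB
namespace EigenData

/-! ### Coefficients are determined by their values on `𝒟⁰` -/

section Determination

variable {R : Type*} [CommRing R] {r : ℕ} {q₀ q : Rˣ} (D : EigenData q₀ q)

/-- The parameter is a unit, so the coefficient at the longer element is determined by that at the
shorter one. -/
lemma coeff_s_mul {i : Fin r} {h : Hecke R r q₀ q} {κ : R} (he : Tgen q₀ q i * h = κ • h)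
    {z : W r} (hz : Asc i z) : param q₀ q i * vec h (s i * z) = κ * vec h z := by
  have h1 : vec (Tgen q₀ q i * h) z = vec (κ • h) z := by rw [he]
  rwa [vec_Tgen_mul, leftMul_apply, if_pos hz, vec_smul, Pi.smul_apply, smul_eq_mul] at h1

lemma vec_Tgen_mul_of_asc {i : Fin r} (h : Hecke R r q₀ q) {z : W r} (hz : Asc i z) :
    vec (Tgen q₀ q i * h) z = param q₀ q i * vec h (s i * z) := by
  rw [vec_Tgen_mul, leftMul_apply, if_pos hz]

lemma vec_Tgen_mul_eq_zero {i : Fin r} {h : Hecke R r q₀ q} {n : ℕ}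
    (hn : ∀ z : W r, length z < n + 1 → vec h z = 0) {z : W r} (hz : length z < n) :
    vec (Tgen q₀ q i * h) z = 0 := by
  rw [vec_Tgen_mul, leftMul_apply, hn z (by omega),
    hn _ (lt_of_le_of_lt (length_s_mul_le i z) (by omega))]
  simp

lemma Tgen_mul_pi_mul {a : ℕ} (ha : a ≤ r) {k : Fin r} (h0 : k.val ≠ 0) (hk : k.val ≠ a)
    (z : Hecke R r q₀ q) : Tgen q₀ q k * (D.pi r a * z) = D.pi r a * (Tgen q₀ q k * z) := by
  rw [← mul_assoc, (D.Tgen_commute_pi h0 a ha hk).eq, mul_assoc]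

/-- An element of `π_a H` whose coefficients vanish below the length of `w` vanishes at `w`, if
`w` makes one of the first `a` letters negative. -/
lemma vec_eq_zero_of_neg {a : ℕ} (ha : a ≤ r) (n : ℕ) : ∀ {i : Fin r}, i.val = n → i.val < a →
    ∀ {w : W r}, window w i < 0 → (∀ k < i, 0 < window w k) → ∀ z : Hecke R r q₀ q,
    (∀ w', length w' < length w → vec (D.pi r a * z) w' = 0) → vec (D.pi r a * z) w = 0 := by
  induction n with
  | zero =>
    intro i hi hia w h1 _ z hz
    have h2 : ¬ Asc i w := by rw [asc_zero hi]; omega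
    have h3 := length_of_not_asc h2
    have h4 : Tgen q₀ q i * (D.pi r a * z) = D.κ₀ • (D.pi r a * z) := by
      rw [← mul_assoc, D.Tgen_zero_mul_pi hi a ha (by omega), smul_mul_assoc]
    have h5 := coeff_s_mul h4 (asc_s_mul.2 h2)
    rw [s_mul_s_mul, hz (s i * w) (by omega), mul_zero, param_zero hi] at h5
    exact (Units.mul_right_eq_zero q₀).1 h5
  | succ n ih =>
    intro i hi hia w h1 h2 z hz
    obtain ⟨p, hp⟩ := exists_pred (k := i) (by omega)
    have hpi : p < i := by rw [Fin.lt_def]; omega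
    have h3 : ¬ Asc i w := by rw [asc_succ hp]; have := h2 p hpi; omega
    have h7 := length_of_not_asc h3
    -- `T_{s_i}` commutes with `π_a`, so `T_{s_i} h` again lies in `π_a H'`. Its coefficient at the
    -- shorter element `s_i w` is `q` times that of `h` at `w`.
    have h4 := ih (i := p) (by omega) (by omega) (w := s i * w)
      (by rw [s_succ hp, window_swap_mul, Equiv.swap_apply_left]; exact h1)
      (fun k hk => by
        rw [s_succ hp, window_swap_mul,
          Equiv.swap_apply_of_ne_of_ne (ne_of_lt hk) (ne_of_lt (hk.trans hpi))]
        exact h2 k (hk.trans hpi)) (Tgen q₀ q i * z)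
    rw [← D.Tgen_mul_pi_mul ha (by omega) (by omega)] at h4
    have h5 := h4 fun w' hw' => vec_Tgen_mul_eq_zero (n := length (s i * w))
      (fun z' hz' => hz z' (by omega)) hw'
    rw [vec_Tgen_mul_of_asc _ (asc_s_mul.2 h3), s_mul_s_mul, param_succ (by omega)] at h5
    exact (Units.mul_right_eq_zero q).1 h5

/-- At the first place this is the eigenvector equation of `T_{s_0}`. Otherwise the small entry is
moved to the left: it is less than its left neighbour in absolute value, so passing to `T_{s_i} h`
multiplies both coefficients by `q`, which cancels. -/
lemma coeff_flip_mul {a : ℕ} (ha : a ≤ r) (n : ℕ) : ∀ {i : Fin r}, i.val = n → i.val < a →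
    ∀ {w : W r}, 0 < window w i → (∀ k < i, window w i < window w k) → ∀ z : Hecke R r q₀ q,
    q₀ * vec (D.pi r a * z) (flip i * w) = D.κ₀ * vec (D.pi r a * z) w := by
  induction n with
  | zero =>
    intro i hi hia w h1 _ z
    have h4 : Tgen q₀ q i * (D.pi r a * z) = D.κ₀ • (D.pi r a * z) := by
      rw [← mul_assoc, D.Tgen_zero_mul_pi hi a ha (by omega), smul_mul_assoc]
    have h5 := coeff_s_mul h4 ((asc_zero hi w).2 h1)
    rwa [param_zero hi, s_zero hi] at h5
  | succ n ih =>
    intro i hi hia w h1 h2 z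
    obtain ⟨p, hp⟩ := exists_pred (k := i) (by omega)
    have hpi : p < i := by rw [Fin.lt_def]; omega
    have h3 : ¬ Asc i w := by rw [asc_succ hp]; have := h2 p hpi; omega
    have hwp : window (s i * w) p = window w i := by
      rw [s_succ hp, window_swap_mul, Equiv.swap_apply_left]
    have hwi : window (s i * w) i = window w p := by
      rw [s_succ hp, window_swap_mul, Equiv.swap_apply_right]
    have h4 := ih (i := p) (by omega) (by omega) (w := s i * w) (by rw [hwp]; exact h1)
      (fun k hk => by
        rw [hwp, s_succ hp, window_swap_mul,
          Equiv.swap_apply_of_ne_of_ne (ne_of_lt hk) (ne_of_lt (hk.trans hpi))]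
        exact h2 k (hk.trans hpi)) (Tgen q₀ q i * z)
    have h6 : Asc i (flip p * (s i * w)) := by
      rw [asc_succ hp, window_flip_mul_self, window_flip_mul_ne _ (ne_of_gt hpi), hwp, hwi]
      have := h2 p hpi
      omega
    have h7 : s i * (flip p * (s i * w)) = flip i * w := by
      rw [← mul_assoc (s i), s_mul_flip hp, mul_assoc, s_mul_s_mul]
    rw [← D.Tgen_mul_pi_mul ha (by omega) (by omega), vec_Tgen_mul_of_asc _ (asc_s_mul.2 h3),
      vec_Tgen_mul_of_asc _ h6, h7, s_mul_s_mul, param_succ (by omega)] at h4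
    have h8 : (q : R) * (q₀ * vec (D.pi r a * z) (flip i * w)) =
        q * (D.κ₀ * vec (D.pi r a * z) w) := by linear_combination h4
    exact (Units.mul_right_inj q).1 h8

/-- The elements of `x_λ H` are determined by their coefficients on `𝒟_λ`. -/
lemma vec_eq_zero_of_not_normal {a : ℕ} {P : Set ℕ} (hP : a ∈ P) (ha : a ≤ r)
    (z : Hecke R r q₀ q) {w : W r} (hw : ¬ Normal a P w)
    (hz : ∀ w', length w' < length w → vec (D.elem r a P * z) w' = 0) :
    vec (D.elem r a P * z) w = 0 := by
  by_cases hneg : ∃ i : Fin r, i.val < a ∧ window w i < 0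
  · obtain ⟨i, hi, h1, h2⟩ := exists_first_neg hneg
    rw [elem, mul_assoc] at hz ⊢
    exact D.vec_eq_zero_of_neg ha _ rfl hi h1 h2 _ hz
  · have hex : ∃ p k : Fin r, p.val + 1 = k.val ∧ k.val ∉ P ∧ ¬ Asc k w := by
      by_contra! hcon
      push Not at hneg
      exact hw ⟨fun i hi => lt_of_le_of_ne (hneg i hi) (window_ne_zero w i).symm,
        fun p k hpk hk => (asc_succ hpk w).1 (hcon p k hpk hk)⟩
    obtain ⟨p, k, hpk, hk, hnot⟩ := hex
    have h0 : k.val ≠ 0 := by omega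
    have h3 := length_of_not_asc hnot
    have h4 : Tgen q₀ q k * (D.elem r a P * z) = D.κ • (D.elem r a P * z) := by
      rw [← mul_assoc, D.Tgen_mul_elem hP ha h0 hk, smul_mul_assoc]
    have h5 := coeff_s_mul h4 (asc_s_mul.2 hnot)
    rw [s_mul_s_mul, hz (s k * w) (by omega), mul_zero, param_succ h0] at h5
    exact (Units.mul_right_eq_zero q).1 h5

lemma window_inv_inv (w : W r) (j : Fin r) (h : 0 < window w⁻¹ j) :
    window w⁻¹ j = (w.right j).val + 1 ∧ window w (w.right j) = j.val + 1 := by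
  have h1 : w.left (w.right j) = 1 := by
    rw [window_inv] at h
    rcases Int.units_eq_one_or (w.left (w.right j)) with h1 | h1
    · exact h1
    · rw [h1] at h; push_cast at h; omega
  rw [window_inv, h1, window_of_left_one h1]
  simp

variable (D' : EigenData q₀ q)

/-- An element of `x_λ H ∩ H y_μ` which vanishes on `𝒟⁰_{λ,μ}` is zero. -/
theorem eq_zero_of_vanish {a b : ℕ} {P Q : Set ℕ} (hP : a ∈ P) (ha : a ≤ r) (hQ : b ∈ Q)
    (hb : b ≤ r) (h₀ : D.κ₀ - D'.κ₀ ∈ nonZeroDivisors R)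
    (h₁ : D.κ - D'.κ ∈ nonZeroDivisors R ∨ P = Set.univ) {h : Hecke R r q₀ q}
    (hl : ∃ z, h = D.elem r a P * z) (hr : ∃ z, h = z * D'.elem r b Q)
    (hv : ∀ d ∈ dist₀Of a P b Q, vec h d = 0) : h = 0 := by
  obtain ⟨z, hz⟩ := hl
  obtain ⟨z', hz'⟩ := hr
  have hrev : rev h = D'.elem r b Q * rev z' := by
    rw [hz', rev_mul, D'.rev_elem hQ hb]
  have hvr : ∀ w, vec h w = vec (rev h) w⁻¹ := fun w => by
    rw [vec_rev, invert_apply, inv_inv]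
  have key : ∀ n : ℕ, ∀ w : W r, length w = n → vec h w = 0 := by
    intro n
    induction n using Nat.strong_induction_on with
    | _ n ih =>
      intro w hw
      have hlow : ∀ w', length w' < length w → vec h w' = 0 := fun w' hw' =>
        ih _ (hw ▸ hw') w' rfl
      by_cases hN : Normal a P w
      swap
      · rw [hz] at hlow ⊢
        exact D.vec_eq_zero_of_not_normal hP ha z hN hlow
      by_cases hN' : Normal b Q w⁻¹
      swap
      · rw [hvr, hrev]
        refine D'.vec_eq_zero_of_not_normal hQ hb _ hN' fun w' hw' => ?_
        rw [← hrev, vec_rev, invert_apply]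
        exact hlow _ (by simpa using hw')
      by_cases hd : w ∈ dist₀Of a P b Q
      · exact hv w hd
      by_cases hdisj : ∀ j : Fin r, j.val < b → a ≤ (w.right j).val
      · obtain ⟨k, m, hk0, hkP, hm0, hmQ, hkm⟩ := exists_common_reflection hP hQ hN hN' hd hdisj
        obtain ⟨p, hp⟩ := exists_pred hk0
        obtain ⟨p', hp'⟩ := exists_pred hm0
        have e1 : Tgen q₀ q k * h = D.κ • h := by
          rw [hz, ← mul_assoc, D.Tgen_mul_elem hP ha hk0 hkP, smul_mul_assoc]
        have e2 : Tgen q₀ q m * rev h = D'.κ • rev h := by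
          rw [hrev, ← mul_assoc, D'.Tgen_mul_elem hQ hb hm0 hmQ, smul_mul_assoc]
        have e3 := coeff_s_mul e1 ((asc_succ hp w).2 (hN.step p k hp hkP))
        have e4 := coeff_s_mul e2 ((asc_succ hp' _).2 (hN'.step p' m hp' hmQ))
        have e5 : vec (rev h) (s m * w⁻¹) = vec h (s k * w) := by
          rw [hvr, hkm, mul_inv_rev, s_inv]
        rw [e5, ← hvr, param_succ hm0] at e4
        rw [param_succ hk0] at e3
        rcases h₁ with h₁ | h₁
        -- `s_k w = w s_m`, so one coefficient has been computed from both sides, with factors `κ`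
        -- and `κ'`.
        · refine (mul_right_mem_nonZeroDivisors_eq_zero_iff h₁).1 ?_
          linear_combination e4 - e3
        · rw [h₁] at hkP; exact absurd (Set.mem_univ _) hkP
      · push Not at hdisj
        -- the smallest common letter
        obtain ⟨j, ⟨hj, hja⟩, hmin⟩ := Finset.exists_min_image
          (Finset.univ.filter fun j : Fin r => j.val < b ∧ (w.right j).val < a)
          (fun j => (w.right j).val) (by
            obtain ⟨j, hj⟩ := hdisj
            exact ⟨j, by simpa using hj⟩) |>.imp fun j hj => by simpa using hj
        obtain ⟨w1, w2⟩ := window_inv_inv w j (hN'.pos j hj)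
        -- Minimality of the place serves both sides: an earlier place with a smaller entry, or a
        -- smaller letter at an earlier place, would be a common letter at a smaller place.
        have e1 := D.coeff_flip_mul ha _ rfl hja (w := w) (by rw [w2]; omega)
          (fun k hk => by
            rw [Fin.lt_def] at hk
            have h1 := window_of_left_one (window_pos_iff.1 (hN.pos k (by omega)))
            rw [w2, h1]
            by_contra hlt
            have h2 : w.right (w.right⁻¹ k) = k := by simp
            have h3 := hmin (w.right⁻¹ k) (by omega) (by rw [h2]; omega)
            rw [h2] at h3
            omega) (D.youngSum r P * z)
        have e2 := D'.coeff_flip_mul hb _ rfl hj (w := w⁻¹) (hN'.pos j hj)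
          (fun k hk => by
            rw [Fin.lt_def] at hk
            obtain ⟨w3, -⟩ := window_inv_inv w k (hN'.pos k (by omega))
            rw [w1, w3]
            by_contra hlt
            have h3 := hmin k (by omega) (by omega)
            have h4 : w.right k = w.right j := Fin.ext (by omega)
            have h5 := w.right.injective h4
            rw [h5] at hk
            exact lt_irrefl _ hk) (D'.youngSum r Q * rev z')
        rw [← mul_assoc, ← elem, ← hz] at e1
        rw [← mul_assoc, ← elem, ← hrev] at e2
        have e5 : vec (rev h) (flip j * w⁻¹) = vec h (flip (w.right j) * w) := by
          rw [hvr, ← mul_flip, mul_inv_rev, flip_inv]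
        rw [e5, ← hvr] at e2
        refine (mul_right_mem_nonZeroDivisors_eq_zero_iff h₀).1 ?_
        linear_combination e2 - e1
  exact vec_injective (funext fun w => key _ w rfl)

end Determination

end EigenData
end HeckeB

namespace HeckeB

/-! ### Triangularity of multiplication by `π_a` -/

section Support

variable {R : Type*} [CommRing R] {r : ℕ} {q₀ q : Rˣ}

/-- `v` vanishes outside `S`. -/
def SupportedOn (S : Set (W r)) (v : W r → R) : Prop := ∀ z, v z ≠ 0 → z ∈ S

/-- `T_s T_z` involves `T_{sz}`, and `T_z` itself only when `s` is a descent of `z`. -/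
lemma SupportedOn.leftMul {S S' : Set (W r)} {v : W r → R} (hv : SupportedOn S v) {i : Fin r}
    (h : ∀ z ∈ S, s i * z ∈ S' ∧ (¬ Asc i z → z ∈ S')) :
    SupportedOn S' (leftMul q₀ q i v) := by
  intro z hz
  rw [leftMul_apply] at hz
  have h1 : v (s i * z) ≠ 0 → z ∈ S' := fun h1 => by
    have := (h _ (hv _ h1)).1
    rwa [s_mul_s_mul] at this
  split_ifs at hz with hasc
  · exact h1 (right_ne_zero_of_mul hz)
  · by_cases h2 : v (s i * z) = 0
    · rw [h2, zero_add] at hz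
      exact (h z (hv z (right_ne_zero_of_mul hz))).2 hasc
    · exact h1 h2

lemma SupportedOn.add {S : Set (W r)} {v v' : W r → R} (h : SupportedOn S v)
    (h' : SupportedOn S v') : SupportedOn S (v + v') := by
  intro z hz
  by_cases h1 : v z = 0
  · refine h' z fun h2 => hz ?_
    rw [Pi.add_apply, h1, h2, add_zero]
  · exact h z h1

lemma SupportedOn.smul {S : Set (W r)} {v : W r → R} (h : SupportedOn S v) (c : R) :
    SupportedOn S (c • v) :=
  fun z hz => h z (right_ne_zero_of_mul (by simpa using hz))

lemma SupportedOn.mono {S S' : Set (W r)} {v : W r → R} (h : SupportedOn S v) (hS : S ⊆ S') :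
    SupportedOn S' v := fun z hz => hS (h z hz)

lemma supportedOn_single {S : Set (W r)} {w : W r} (hw : w ∈ S) :
    SupportedOn S (Pi.single w (1 : R)) := by
  intro z hz
  by_cases h : z = w
  · rwa [h]
  · simp [h] at hz

/-- Left multiplication by `T_{t_m}` creates a negative letter among the first ones. -/
lemma supportedOn_T_flip_mul (k : ℕ) (f : Fin r → ℤ) (n : ℕ) : ∀ {m : Fin r}, m.val = n → n ≤ k →
    ∀ {h : Hecke R r q₀ q},
    SupportedOn {z | (∀ i : Fin r, k < i.val → window z i = f i) ∧ 0 < window z m} (vec h) →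
    SupportedOn {z | (∀ i : Fin r, k < i.val → window z i = f i) ∧
      ∃ i : Fin r, i.val ≤ k ∧ window z i < 0} (vec (T q₀ q (flip m) * h)) := by
  induction n with
  | zero =>
    intro m hm hk h hh
    rw [T_flip_zero hm, vec_Tgen_mul]
    refine hh.leftMul ?_
    rintro z ⟨hz1, hz2⟩
    refine ⟨⟨fun i hi => ?_, m, by omega, ?_⟩, fun hn => absurd ((asc_zero hm z).2 hz2) hn⟩
    · rw [s_zero hm, window_flip_mul_ne _ (by rintro rfl; omega), hz1 i hi]
    · rw [s_zero hm, window_flip_mul_self]; omega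
  | succ n ih =>
    intro m hm hk h hh
    obtain ⟨p, hp⟩ := exists_pred (k := m) (by omega)
    rw [T_flip_succ hp, mul_assoc, mul_assoc, vec_Tgen_mul]
    refine SupportedOn.leftMul (ih (m := p) (by omega) (by omega)
      (h := Tgen q₀ q m * h) ?_) ?_
    · rw [vec_Tgen_mul]
      refine hh.leftMul ?_
      rintro z ⟨hz1, hz2⟩
      refine ⟨⟨fun i hi => ?_, ?_⟩, fun hn => ⟨hz1, ?_⟩⟩
      · rw [s_succ hp, window_swap_mul, Equiv.swap_apply_of_ne_of_ne (by rintro rfl; omega)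
          (by rintro rfl; omega), hz1 i hi]
      · rw [s_succ hp, window_swap_mul, Equiv.swap_apply_left]; exact hz2
      -- At a descent the entry at `p` exceeds the positive entry at `m`, so the extra term is
      -- positive at `p` too.
      · rw [asc_succ hp] at hn; omega
    · rintro z ⟨hz1, i, hi, hz2⟩
      refine ⟨⟨fun i hi => ?_, Equiv.swap p m i, ?_, ?_⟩, fun _ => ⟨hz1, i, hi, hz2⟩⟩
      · rw [s_succ hp, window_swap_mul, Equiv.swap_apply_of_ne_of_ne (by rintro rfl; omega)
          (by rintro rfl; omega), hz1 i hi]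
      · rw [Equiv.swap_apply_def]; split_ifs <;> omega
      · rw [s_succ hp, window_swap_mul, Equiv.swap_apply_self]; exact hz2

end Support

namespace EigenData

variable {R : Type*} [CommRing R] {r : ℕ} {q₀ q : Rˣ} (D : EigenData q₀ q)

/-- The leading coefficient of `π_a`. -/
def lead (a : ℕ) : Rˣ := ∏ i ∈ Finset.range a, D.α * q ^ i

/-- The constant `α q^a` of each new factor contributes to the leading coefficient. Its term `β T_t`
creates a negative letter in every summand, because the preceding factors have left the entry at the
new place unchanged and positive. -/
lemma supportedOn_pi_mul_T {w : W r} : ∀ a ≤ r, (∀ i : Fin r, i.val < a → 0 < window w i) →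
    ∃ e : W r → R, vec (D.pi r a * T q₀ q w) = (D.lead a : R) • Pi.single w 1 + e ∧
      SupportedOn {z | (∀ i : Fin r, a ≤ i.val → window z i = window w i) ∧
        ∃ i : Fin r, i.val < a ∧ window z i < 0} e := by
  intro a
  induction a with
  | zero =>
    intro _ _
    refine ⟨0, ?_, fun z hz => absurd rfl hz⟩
    simp [pi_zero, lead]
  | succ a ih =>
    intro ha hw
    obtain ⟨e, he, hs⟩ := ih (by omega) fun i hi => hw i (by omega)
    set k : Fin r := ⟨a, ha⟩
    have hk : k.val = a := rfl
    refine ⟨((D.α : R) * q ^ a) • e + D.β • vec (T q₀ q (flip k) * (D.pi r a * T q₀ q w)), ?_, ?_⟩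
    · rw [pi_succ D ha, ← (D.factor_commute_pi _ (by omega)).eq, mul_assoc, factor, add_mul,
        vec_add, smul_mul_assoc, smul_mul_assoc, one_mul, vec_smul, vec_smul, he, smul_add,
        smul_smul, add_assoc]
      congr 2
      rw [lead, lead, Finset.prod_range_succ]
      push_cast
      ring
    · refine SupportedOn.add (SupportedOn.smul (hs.mono ?_) _) (SupportedOn.smul ?_ _)
      · rintro z ⟨hz1, i, hi, hz2⟩
        exact ⟨fun i hi => hz1 i (by omega), i, by omega, hz2⟩
      · refine SupportedOn.mono (supportedOn_T_flip_mul a (window w) a (m := k) rfl le_rfl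
          (h := D.pi r a * T q₀ q w) ?_) ?_
        · rw [he]
          refine SupportedOn.add (SupportedOn.smul (supportedOn_single ?_) _) (hs.mono ?_)
          · exact ⟨fun _ _ => rfl, hw k (by omega)⟩
          · rintro z ⟨hz1, -⟩
            refine ⟨fun i hi => hz1 i (by omega), ?_⟩
            rw [hz1 k le_rfl]
            exact hw k (by omega)
        · rintro z ⟨hz1, i, hi, hz2⟩
          exact ⟨fun i hi => hz1 i (by omega), i, by omega, hz2⟩

/-- All terms of `π_a T_w` but the leading one have a negative letter among the first `a`, so they
do not contribute at `d`. -/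
lemma vec_pi_mul {a : ℕ} (ha : a ≤ r) {h : Hecke R r q₀ q}
    (hh : ∀ w, vec h w ≠ 0 → ∀ i : Fin r, i.val < a → 0 < window w i) {d : W r}
    (hd : ∀ i : Fin r, i.val < a → 0 < window d i) :
    vec (D.pi r a * h) d = D.lead a * vec h d := by
  have h1 : vec (D.pi r a * h) = ∑ w, vec h w • vec (D.pi r a * T q₀ q w) := by
    conv_lhs => rw [eq_sum_T h, Finset.mul_sum, ← vecEquiv_apply, map_sum]
    refine Finset.sum_congr rfl fun w _ => ?_
    rw [mul_smul_comm, map_smul, vecEquiv_apply]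
  rw [h1, Finset.sum_apply, Finset.sum_eq_single d]
  · by_cases h0 : vec h d = 0
    · simp [h0]
    obtain ⟨e, he, hs⟩ := D.supportedOn_pi_mul_T a ha hd
    have h2 : e d = 0 := by
      by_contra h2
      obtain ⟨-, i, hi, hneg⟩ := hs d h2
      have := hd i hi
      omega
    rw [Pi.smul_apply, he, Pi.add_apply, h2, Pi.smul_apply, Pi.single_eq_same]
    simp [mul_comm]
  · intro w _ hwd
    by_cases h0 : vec h w = 0
    · simp [h0]
    obtain ⟨e, he, hs⟩ := D.supportedOn_pi_mul_T a ha (hh w h0)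
    have h2 : e d = 0 := by
      by_contra h2
      obtain ⟨-, i, hi, hneg⟩ := hs d h2
      have := hd i hi
      omega
    rw [Pi.smul_apply, he, Pi.add_apply, h2, Pi.smul_apply, Pi.single_eq_of_ne hwd.symm]
    simp
  · intro h2; exact absurd (Finset.mem_univ _) h2

lemma vec_mul_pi {b : ℕ} (hb : b ≤ r) {h : Hecke R r q₀ q}
    (hh : ∀ w, vec h w ≠ 0 → ∀ i : Fin r, i.val < b → 0 < window w⁻¹ i) {d : W r}
    (hd : ∀ i : Fin r, i.val < b → 0 < window d⁻¹ i) :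
    vec (h * D.pi r b) d = D.lead b * vec h d := by
  have h1 : vec (h * D.pi r b) d = vec (D.pi r b * rev h) d⁻¹ := by
    rw [← rev_rev (h * D.pi r b), vec_rev, rev_mul, rev_pi D b hb, invert_apply]
  rw [h1, D.vec_pi_mul hb (fun w hw i hi => ?_) hd, vec_rev, invert_apply, inv_inv]
  rw [vec_rev, invert_apply] at hw
  have := hh _ hw i hi
  rwa [inv_inv] at this

/-- Right multiplication by `π_b` does not create negative letters among the first `a` ones, if
they are not moved to the first `b` ones. -/
lemma window_pos_of_vec_mul_pi {a b : ℕ} (hb : b ≤ r) {h : Hecke R r q₀ q}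
    (h1 : ∀ w, vec h w ≠ 0 → ∀ i : Fin r, i.val < a → 0 < window w i)
    (h2 : ∀ w, vec h w ≠ 0 → ∀ i : Fin r, i.val < b → 0 < window w⁻¹ i)
    (h3 : ∀ w, vec h w ≠ 0 → ∀ j : Fin r, j.val < b → a ≤ (w.right j).val) {y : W r}
    (hy : vec (h * D.pi r b) y ≠ 0) (i : Fin r) (hi : i.val < a) : 0 < window y i := by
  have e1 : h * D.pi r b = ∑ w, vec h w • rev (D.pi r b * T q₀ q w⁻¹) := by
    conv_lhs => rw [eq_sum_T h, Finset.sum_mul]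
    refine Finset.sum_congr rfl fun w _ => ?_
    rw [rev_mul, rev_T, inv_inv, rev_pi D b hb, smul_mul_assoc]
  rw [e1, ← vecEquiv_apply, map_sum, Finset.sum_apply] at hy
  obtain ⟨w, -, hw⟩ := Finset.exists_ne_zero_of_sum_ne_zero hy
  rw [map_smul, vecEquiv_apply, vec_rev, Pi.smul_apply, smul_eq_mul, invert_apply] at hw
  have hw0 := left_ne_zero_of_mul hw
  have hw1 := right_ne_zero_of_mul hw
  obtain ⟨e, he, hs⟩ := D.supportedOn_pi_mul_T b hb (h2 w hw0)
  -- Right multiplication by `π_b` does not move the letters after the first `b`, and by `h3` the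
  -- first `a` places carry only such letters.
  have hmem : ∀ j : Fin r, b ≤ j.val → window y⁻¹ j = window w⁻¹ j := by
    by_cases hyw : y⁻¹ = w⁻¹
    · rw [hyw]; intro _ _; rfl
    · rw [he, Pi.add_apply, Pi.smul_apply, Pi.single_eq_of_ne hyw, smul_zero, zero_add] at hw1
      exact (hs _ hw1).1
  have hpos := window_pos_iff.1 (h1 w hw0 i hi)
  have hwj : w.right (w.right⁻¹ i) = i := by simp
  have hj : b ≤ (w.right⁻¹ i).val := by
    by_contra hlt
    have := h3 w hw0 (w.right⁻¹ i) (by omega)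
    rw [hwj] at this
    omega
  have h4 := hmem _ hj
  have h5 : window w⁻¹ (w.right⁻¹ i) = i.val + 1 := by
    rw [window_inv, hwj, hpos]; simp
  rw [h5] at h4
  obtain ⟨h6, h7⟩ := window_inv_inv y (w.right⁻¹ i) (by rw [h4]; omega)
  have h8 : y.right (w.right⁻¹ i) = i := Fin.ext (by omega)
  rw [h8] at h7
  rw [h7]
  omega

end EigenData

/-! ### Products of Young subgroups with elements of `𝒟⁰` -/

section Product

variable {R : Type*} [CommRing R] {r : ℕ} {q₀ q : Rˣ}

lemma sameBlock_inv {P : Set ℕ} {g : W r} (h : ∀ i : Fin r, SameBlock P i (g.right i)) (i : Fin r) :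
    SameBlock P i (g.right⁻¹ i) := by
  have h1 := (h (g.right⁻¹ i)).symm
  rwa [← Equiv.Perm.mul_apply, mul_inv_cancel, Equiv.Perm.one_apply] at h1

/-- The window of `z` increases on the blocks, so it does not change which generators are ascents,
and the lengths add up. Signs play no part, whence `Normal 0`. -/
lemma T_young_mul_T {a : ℕ} {P : Set ℕ} (ha : a ∈ P) {z : W r} (hz : Normal 0 P z) (n : ℕ) :
    ∀ {g : W r}, length g = n → g ∈ youngOf P →
    T (R := R) q₀ q g * T q₀ q z = T q₀ q (g * z) := by
  induction n with
  | zero =>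
    intro g hg hP
    by_cases h1 : g = 1
    · rw [h1, T_one, one_mul, one_mul]
    · obtain ⟨k, _, _, hk⟩ := exists_not_asc_of_mem_youngOf ha hP h1
      have := length_of_not_asc hk
      omega
  | succ n ih =>
    intro g hg hP
    by_cases h1 : g = 1
    · rw [h1, T_one, one_mul, one_mul]
    · obtain ⟨k, h0, hkP, hk⟩ := exists_not_asc_of_mem_youngOf ha hP h1
      obtain ⟨p, hp⟩ := exists_pred h0
      have h2 := length_of_not_asc hk
      have hasc := asc_s_mul.2 hk
      have hP' : s k * g ∈ youngOf P := mul_mem (s_mem_youngOf h0 hkP) hP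
      have h3 := Tgen_mul_T (R := R) (q₀ := q₀) (q := q) hasc
      obtain ⟨hg1, hg2⟩ := youngOf_spec hP'
      have h4 : Asc k (s k * g * z) := by
        rw [asc_succ hp] at hasc ⊢
        rw [window_of_left_one (hg1 _), window_of_left_one (hg1 _)] at hasc
        rw [window_mul, window_mul, hg1, hg1, Units.val_one, one_mul, one_mul]
        refine hz.window_lt (by rw [Fin.lt_def]; omega) ?_
        exact (sameBlock_inv hg2 p).symm.trans
          ((sameBlock_of_not_mem hp hkP).trans (sameBlock_inv hg2 k))
      have h5 := Tgen_mul_T (R := R) (q₀ := q₀) (q := q) h4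
      rw [s_mul_s_mul] at h3
      rw [← h3, mul_assoc, ih (by omega) hP', h5, mul_assoc, s_mul_s_mul]

lemma inv_mem_dist₀Of {a b : ℕ} {P Q : Set ℕ} {d : W r} (hd : d ∈ dist₀Of a P b Q) :
    d⁻¹ ∈ dist₀Of b Q a P := by
  obtain ⟨h1, h2, h3⟩ := hd
  refine ⟨h2, by rwa [inv_inv], fun g hg hg' => ?_⟩
  rw [inv_inv] at hg' ⊢
  have h4 := h3 _ hg' (by
    have : d⁻¹ * (d * g * d⁻¹) * d = g := by group
    rwa [this])
  have h5 : d⁻¹ * (d * g * d⁻¹) * d = g := by group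
  rw [h5] at h4
  rw [h4]
  group

lemma window_pos_double {a b : ℕ} {P Q : Set ℕ} (ha : a ∈ P) {d g g' : W r}
    (hd : d ∈ dist₀Of a P b Q) (hg : g ∈ youngOf P) (hg' : g' ∈ youngOf Q) (i : Fin r)
    (hi : i.val < a) : 0 < window (g * d * g') i := by
  obtain ⟨h1, h2⟩ := youngOf_spec hg
  have h3 := sameBlock_inv h2 i a ha
  have h4 := window_pos_iff.1 (((mem_distOf_iff ha).1 hd.1).pos (g.right⁻¹ i) (by omega))
  rw [mul_assoc, window_mul, window_mul, h1, h4, window_of_left_one ((youngOf_spec hg').1 _)]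
  push_cast
  omega

lemma right_double {a b : ℕ} {P Q : Set ℕ} (ha : a ∈ P) (hb : b ∈ Q) {d g g' : W r}
    (hd : d ∈ dist₀Of a P b Q) (hg : g ∈ youngOf P) (hg' : g' ∈ youngOf Q) (j : Fin r)
    (hj : j.val < b) : a ≤ ((g * d * g').right j).val := by
  have h1 := (youngOf_spec hg').2 j b hb
  have h2 := not_common_letter hd (j := g'.right j) (by omega)
  have h3 := (youngOf_spec hg).2 (d.right (g'.right j)) a ha
  have h4 : (g * d * g').right j = g.right (d.right (g'.right j)) := rfl
  rw [h4]
  omega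

lemma normal_mul_young {a b : ℕ} {P Q : Set ℕ} (ha : a ∈ P) {d g' : W r}
    (hd : d ∈ dist₀Of a P b Q) (hg' : g' ∈ youngOf Q) : Normal a P (d * g') := by
  refine ⟨fun i hi => ?_, fun p k hpk hk => window_mul_young_lt ha hd hg' hpk hk⟩
  have := window_pos_double ha hd (one_mem _) hg' i hi
  rwa [one_mul] at this

/-- For `d ∈ 𝒟⁰` the element `d g'` is still normal for `P`, so uniqueness of normal elements gives
`g = 1`; after inversion the same argument gives `g' = 1`. -/
lemma eq_of_double_eq {a b : ℕ} {P Q : Set ℕ} (ha : a ∈ P) (hb : b ∈ Q) {d d' g g' : W r}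
    (hd : d ∈ dist₀Of a P b Q) (hd' : d' ∈ dist₀Of a P b Q) (hg : g ∈ youngOf P)
    (hg' : g' ∈ youngOf Q) (h : g * d * g' = d') : g = 1 ∧ g' = 1 ∧ d = d' := by
  have h1 : g = 1 := by
    refine Normal.eq_one ha (youngOf_le a P hg) (normal_mul_young ha hd hg') ?_
    rw [← mul_assoc, h]
    exact (mem_distOf_iff ha).1 hd'.1
  subst h1
  rw [one_mul] at h
  have h2 : g'⁻¹ = 1 := by
    refine Normal.eq_one hb (youngOf_le b Q (inv_mem hg')) ((mem_distOf_iff hb).1 hd.2.1) ?_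
    rw [← mul_inv_rev, h]
    exact (mem_distOf_iff hb).1 hd'.2.1
  rw [inv_eq_one] at h2
  subst h2
  exact ⟨rfl, rfl, by rwa [mul_one] at h⟩

lemma T_double {a b : ℕ} {P Q : Set ℕ} (ha : a ∈ P) (hb : b ∈ Q) {d g g' : W r}
    (hd : d ∈ dist₀Of a P b Q) (hg : g ∈ youngOf P) (hg' : g' ∈ youngOf Q) :
    T (R := R) q₀ q g * T q₀ q d * T q₀ q g' = T q₀ q (g * d * g') := by
  have h1 : T (R := R) q₀ q d * T q₀ q g' = T q₀ q (d * g') := by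
    apply rev.injective
    have h2 := (mem_distOf_iff hb).1 hd.2.1
    rw [rev_mul, rev_T, rev_T, rev_T, mul_inv_rev]
    exact T_young_mul_T hb ⟨fun i hi => absurd hi (Nat.not_lt_zero _), h2.step⟩ _ rfl (inv_mem hg')
  rw [mul_assoc, h1, mul_assoc]
  exact T_young_mul_T ha ⟨fun i hi => absurd hi (Nat.not_lt_zero _),
    (normal_mul_young ha hd hg').step⟩ _ rfl hg

end Product

/-! ### The coefficient matrix on `𝒟⁰` and the intersection -/

namespace EigenData

variable {R : Type*} [CommRing R] {r : ℕ} {q₀ q : Rˣ} (D D' : EigenData q₀ q)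

lemma vec_middle {a b : ℕ} {P Q : Set ℕ} (ha : a ∈ P) (hb : b ∈ Q) {d : W r}
    (hd : d ∈ dist₀Of a P b Q) (z : W r) :
    vec (D.youngSum r P * T q₀ q d * D'.youngSum r Q) z =
      ∑ g ∈ Finset.univ.filter (fun w => w ∈ youngOf P),
        ∑ g' ∈ Finset.univ.filter (fun w => w ∈ youngOf Q),
          D.c ^ length g * D'.c ^ length g' * Pi.single (M := fun _ => R) (g * d * g') 1 z := by
  have h1 : D.youngSum r P * T q₀ q d * D'.youngSum r Q =
      ∑ g ∈ Finset.univ.filter (fun w => w ∈ youngOf P),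
        ∑ g' ∈ Finset.univ.filter (fun w => w ∈ youngOf Q),
          (D.c ^ length g * D'.c ^ length g') • T q₀ q (g * d * g') := by
    rw [youngSum, youngSum, Finset.sum_mul, Finset.sum_mul]
    refine Finset.sum_congr rfl fun g hg => ?_
    rw [Finset.mul_sum]
    refine Finset.sum_congr rfl fun g' hg' => ?_
    rw [smul_mul_assoc, smul_mul_assoc, mul_smul_comm, smul_smul,
      T_double ha hb hd (Finset.mem_filter.1 hg).2 (Finset.mem_filter.1 hg').2]
  rw [h1, ← vecEquiv_apply]
  simp only [map_sum, map_smul, vecEquiv_apply, vec_T, Finset.sum_apply, Pi.smul_apply,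
    smul_eq_mul]

lemma exists_of_vec_middle_ne_zero {a b : ℕ} {P Q : Set ℕ} (ha : a ∈ P) (hb : b ∈ Q) {d : W r}
    (hd : d ∈ dist₀Of a P b Q) {z : W r}
    (hz : vec (D.youngSum r P * T q₀ q d * D'.youngSum r Q) z ≠ 0) :
    ∃ g ∈ youngOf P, ∃ g' ∈ youngOf Q, z = g * d * g' := by
  rw [D.vec_middle D' ha hb hd] at hz
  obtain ⟨g, hg, hz⟩ := Finset.exists_ne_zero_of_sum_ne_zero hz
  obtain ⟨g', hg', hz⟩ := Finset.exists_ne_zero_of_sum_ne_zero hz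
  refine ⟨g, (Finset.mem_filter.1 hg).2, g', (Finset.mem_filter.1 hg').2, ?_⟩
  by_contra hne
  rw [Pi.single_eq_of_ne hne, mul_zero] at hz
  exact hz rfl

lemma vec_middle_dist₀ {a b : ℕ} {P Q : Set ℕ} (ha : a ∈ P) (hb : b ∈ Q) {d d' : W r}
    (hd : d ∈ dist₀Of a P b Q) (hd' : d' ∈ dist₀Of a P b Q) :
    vec (D.youngSum r P * T q₀ q d * D'.youngSum r Q) d' = if d = d' then 1 else 0 := by
  split_ifs with h
  · subst h
    rw [D.vec_middle D' ha hb hd, Finset.sum_eq_single 1, Finset.sum_eq_single 1]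
    · simp
    · intro g' hg' hne
      rw [Pi.single_eq_of_ne, mul_zero]
      intro h
      exact hne (eq_of_double_eq ha hb hd hd' (one_mem _) (Finset.mem_filter.1 hg').2 h.symm).2.1
    · intro h; exact absurd (Finset.mem_filter.2 ⟨Finset.mem_univ _, one_mem _⟩) h
    · intro g hg hne
      refine Finset.sum_eq_zero fun g' hg' => ?_
      rw [Pi.single_eq_of_ne, mul_zero]
      intro h
      exact hne (eq_of_double_eq ha hb hd hd' (Finset.mem_filter.1 hg).2
        (Finset.mem_filter.1 hg').2 h.symm).1
    · intro h; exact absurd (Finset.mem_filter.2 ⟨Finset.mem_univ _, one_mem _⟩) h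
  · by_contra hz
    obtain ⟨g, hg, g', hg', hz⟩ := D.exists_of_vec_middle_ne_zero D' ha hb hd hz
    exact h (eq_of_double_eq ha hb hd hd' hg hg' hz.symm).2.2

/-- The matrix of the coefficients of `x_λ T_d y_μ` on `𝒟⁰_{λ,μ}` is scalar. -/
theorem vec_elem_mul_T_mul_elem {a b : ℕ} {P Q : Set ℕ} (hP : a ∈ P) (ha : a ≤ r) (hQ : b ∈ Q)
    (hb : b ≤ r) {d d' : W r} (hd : d ∈ dist₀Of a P b Q) (hd' : d' ∈ dist₀Of a P b Q) :
    vec (D.elem r a P * T q₀ q d * D'.elem r b Q) d' =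
      if d = d' then ((D.lead a * D'.lead b : Rˣ) : R) else 0 := by
  -- With `π_b` moved to the outside, the middle product is a combination of elements `T_{g d g'}`.
  -- These are positive where the triangularity of `π_a` and `π_b` requires it.
  have h1 : D.elem r a P * T q₀ q d * D'.elem r b Q =
      D.pi r a * (D.youngSum r P * T q₀ q d * D'.youngSum r Q * D'.pi r b) := by
    rw [elem, elem, ← (D'.youngSum_commute_pi D' hQ hb).eq]
    simp only [mul_assoc]
  have hinv : ∀ z, vec (D.youngSum r P * T q₀ q d * D'.youngSum r Q) z ≠ 0 →
      ∀ i : Fin r, i.val < b → 0 < window z⁻¹ i := fun z hz => by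
    obtain ⟨g, hg, g', hg', rfl⟩ := D.exists_of_vec_middle_ne_zero D' hP hQ hd hz
    rw [mul_inv_rev, mul_inv_rev, ← mul_assoc]
    exact window_pos_double hQ (inv_mem_dist₀Of hd) (inv_mem hg') (inv_mem hg)
  rw [h1, D.vec_pi_mul ha (fun z hz => D'.window_pos_of_vec_mul_pi hb ?_ hinv ?_ hz)
    ((mem_distOf_iff hP).1 hd'.1).pos,
    D'.vec_mul_pi hb hinv ((mem_distOf_iff hQ).1 hd'.2.1).pos, D.vec_middle_dist₀ D' hP hQ hd hd']
  · push_cast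
    split_ifs <;> ring
  · intro z hz
    obtain ⟨g, hg, g', hg', rfl⟩ := D.exists_of_vec_middle_ne_zero D' hP hQ hd hz
    exact window_pos_double hP hd hg hg'
  · intro z hz
    obtain ⟨g, hg, g', hg', rfl⟩ := D.exists_of_vec_middle_ne_zero D' hP hQ hd hz
    exact right_double hP hQ hd hg hg'

/-- The elements `x_λ T_d y_μ`. -/
def sandwichElem (a b : ℕ) (P Q : Set ℕ) (w : W r) : Hecke R r q₀ q :=
  D.elem r a P * T q₀ q w * D'.elem r b Q

lemma vec_sum_sandwichElem {a b : ℕ} {P Q : Set ℕ} (hP : a ∈ P) (ha : a ≤ r) (hQ : b ∈ Q)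
    (hb : b ≤ r) (c : dist₀Of (r := r) a P b Q → R) (d : dist₀Of (r := r) a P b Q) :
    vec (∑ w, c w • D.sandwichElem D' a b P Q w.1) d.1 =
      c d * ((D.lead a * D'.lead b : Rˣ) : R) := by
  have hvec : ∀ w : dist₀Of (r := r) a P b Q, vec (D.sandwichElem D' a b P Q w.1) d.1 =
      if w = d then ((D.lead a * D'.lead b : Rˣ) : R) else 0 := fun w => by
    rw [sandwichElem, D.vec_elem_mul_T_mul_elem D' hP ha hQ hb w.2 d.2]
    simp only [Subtype.ext_iff]
  rw [← vecEquiv_apply, map_sum, Finset.sum_apply]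
  simp only [map_smul, vecEquiv_apply, Pi.smul_apply, hvec, smul_eq_mul]
  simp

/-- The matrix on `𝒟⁰` is an invertible scalar, so some combination has the same coefficients there
as `h`. The difference lies in both ideals and vanishes on `𝒟⁰`. -/
lemma eq_sum_sandwichElem {a b : ℕ} {P Q : Set ℕ} (hP : a ∈ P) (ha : a ≤ r) (hQ : b ∈ Q)
    (hb : b ≤ r) (h₀ : D.κ₀ - D'.κ₀ ∈ nonZeroDivisors R)
    (h₁ : D.κ - D'.κ ∈ nonZeroDivisors R ∨ P = Set.univ) {h z z' : Hecke R r q₀ q}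
    (hz : D.elem r a P * z = h) (hz' : z' * D'.elem r b Q = h) :
    ∃ c : dist₀Of (r := r) a P b Q → R, h = ∑ w, c w • D.sandwichElem D' a b P Q w.1 := by
  let c : dist₀Of (r := r) a P b Q → R :=
    fun d => vec h d.1 * (((D.lead a * D'.lead b)⁻¹ : Rˣ) : R)
  refine ⟨c, ?_⟩
  obtain ⟨S, hS⟩ : ∃ S, S = ∑ w, c w • D.sandwichElem D' a b P Q w.1 := ⟨_, rfl⟩
  rw [← hS]
  have hu : ∃ u, S = D.elem r a P * u := by
    refine ⟨∑ w : dist₀Of (r := r) a P b Q, c w • (T q₀ q w.1 * D'.elem r b Q), ?_⟩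
    rw [hS, Finset.mul_sum]
    refine Finset.sum_congr rfl fun w _ => ?_
    rw [mul_smul_comm, sandwichElem, mul_assoc]
  have hu' : ∃ u, S = u * D'.elem r b Q := by
    refine ⟨∑ w : dist₀Of (r := r) a P b Q, c w • (D.elem r a P * T q₀ q w.1), ?_⟩
    rw [hS, Finset.sum_mul]
    refine Finset.sum_congr rfl fun w _ => ?_
    rw [smul_mul_assoc, sandwichElem]
  obtain ⟨u, hu⟩ := hu
  obtain ⟨u', hu'⟩ := hu'
  have hdiff : ∀ d, vec (h + (-1 : R) • S) d = vec h d - vec S d := fun d => by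
    rw [vec_add, vec_smul, Pi.add_apply, Pi.smul_apply, smul_eq_mul]
    ring
  have h0 := D.eq_zero_of_vanish D' hP ha hQ hb h₀ h₁ (h := h + (-1 : R) • S)
    ⟨z + (-1 : R) • u, by rw [mul_add, mul_smul_comm, hz, hu]⟩
    ⟨z' + (-1 : R) • u', by rw [add_mul, smul_mul_assoc, hz', hu']⟩ (fun d hd => by
      have h1 := D.vec_sum_sandwichElem D' hP ha hQ hb c ⟨d, hd⟩
      rw [← hS] at h1
      rw [hdiff, h1, mul_assoc, Units.inv_mul, mul_one, sub_self])
  refine vec_injective (funext fun d => sub_eq_zero.1 ?_)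
  rw [← hdiff, h0]
  rfl

lemma linearIndependent_sandwichElem {a b : ℕ} {P Q : Set ℕ} (hP : a ∈ P) (ha : a ≤ r)
    (hQ : b ∈ Q) (hb : b ≤ r) :
    LinearIndependent R (fun w : dist₀Of (r := r) a P b Q => D.sandwichElem D' a b P Q w.1) := by
  refine LinearIndependent.of_comp vecEquiv.toLinearMap (Fintype.linearIndependent_iff.2 ?_)
  intro c hc d
  have h1 := D.vec_sum_sandwichElem D' hP ha hQ hb c d
  rw [← vecEquiv_apply, map_sum] at h1
  simp only [map_smul] at h1
  have h2 : (0 : R) = c d * ((D.lead a * D'.lead b : Rˣ) : R) :=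
    (congrFun hc d.1).symm.trans h1
  exact (Units.mul_left_eq_zero _).1 h2.symm

/-- The span lies in the sandwich and the sandwich in the intersection; `eq_sum_sandwichElem` closes
the circle. -/
theorem intersection_eq {a b : ℕ} {P Q : Set ℕ} (hP : a ∈ P) (ha : a ≤ r) (hQ : b ∈ Q)
    (hb : b ≤ r) (h₀ : D.κ₀ - D'.κ₀ ∈ nonZeroDivisors R)
    (h₁ : D.κ - D'.κ ∈ nonZeroDivisors R ∨ P = Set.univ) :
    rightIdeal R (D.elem r a P) ⊓ leftIdeal R (D'.elem r b Q) =
        sandwich R (D.elem r a P) (D'.elem r b Q) ∧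
      LinearIndependent R (fun w : dist₀Of (r := r) a P b Q =>
        D.elem r a P * T q₀ q w.1 * D'.elem r b Q) ∧
      Submodule.span R (Set.range (fun w : dist₀Of (r := r) a P b Q =>
        D.elem r a P * T q₀ q w.1 * D'.elem r b Q)) =
        sandwich R (D.elem r a P) (D'.elem r b Q) := by
  have hsp : Submodule.span R (Set.range (fun w : dist₀Of (r := r) a P b Q =>
      D.elem r a P * T q₀ q w.1 * D'.elem r b Q)) ≤
      sandwich R (D.elem r a P) (D'.elem r b Q) := by
    rw [Submodule.span_le]
    rintro _ ⟨w, rfl⟩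
    exact ⟨T q₀ q w.1, rfl⟩
  have hsand : sandwich R (D.elem r a P) (D'.elem r b Q) ≤
      rightIdeal R (D.elem r a P) ⊓ leftIdeal R (D'.elem r b Q) := by
    rintro _ ⟨z, rfl⟩
    exact ⟨⟨z * D'.elem r b Q, by simp [mul_assoc]⟩, ⟨D.elem r a P * z, rfl⟩⟩
  have hint : rightIdeal R (D.elem r a P) ⊓ leftIdeal R (D'.elem r b Q) ≤
      Submodule.span R (Set.range (fun w : dist₀Of (r := r) a P b Q =>
        D.elem r a P * T q₀ q w.1 * D'.elem r b Q)) := by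
    rintro h ⟨⟨z, hz⟩, ⟨z', hz'⟩⟩
    obtain ⟨c, rfl⟩ := D.eq_sum_sandwichElem D' hP ha hQ hb h₀ h₁ hz hz'
    exact Submodule.sum_mem _ fun w _ =>
      Submodule.smul_mem _ _ (Submodule.subset_span (Set.mem_range_self w))
  exact ⟨le_antisymm (hint.trans hsp) hsand, D.linearIndependent_sandwichElem D' hP ha hQ hb,
    le_antisymm hsp (hsand.trans hint)⟩

end EigenData
end HeckeB

namespace HeckeB

/-! ### Specialization to `π_a`, `π_b⁻`, `x_λ` and `y_λ` -/

section Specialization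

variable {R : Type*} [CommRing R] {r : ℕ} (q₀ q : Rˣ)

lemma piPlus_eq (a : ℕ) : piPlus (r := r) q₀ q a = (EigenData.index q₀ q).pi r a := by
  rw [piPlus, EigenData.pi]
  congr 2
  funext i
  simp [EigenData.factor, EigenData.index, t_eq_flip, Algebra.algebraMap_eq_smul_one]

lemma piMinus_eq (a : ℕ) : piMinus (r := r) q₀ q a = (EigenData.sign q₀ q).pi r a := by
  rw [piMinus, EigenData.pi]
  congr 2
  funext i
  have h : ∀ x y : Hecke R r q₀ q, x - y = x + (-1 : R) • y := fun x y => by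
    refine vec_injective (funext fun d => ?_)
    rw [vec_add, vec_smul, Pi.add_apply, Pi.smul_apply, smul_eq_mul, neg_one_mul,
      ← sub_eq_add_neg]
    rfl
  rw [h, t_eq_flip, Algebra.algebraMap_eq_smul_one]
  rfl

lemma youngOf_univ : youngOf (r := r) Set.univ = ⊥ := by
  rw [youngOf, Subgroup.closure_eq_bot_iff]
  rintro w ⟨i, _, hi, _⟩
  exact absurd (Set.mem_univ _) hi

lemma elem_univ (D : EigenData q₀ q) (a : ℕ) : D.elem r a Set.univ = D.pi r a := by
  have h : D.youngSum r Set.univ = 1 := by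
    refine vec_injective (funext fun z => ?_)
    rw [D.vec_youngSum, vec_one, youngOf_univ, Subgroup.mem_bot]
    by_cases hz : z = 1
    · subst hz; simp
    · simp [hz]
  rw [EigenData.elem, h, mul_one]

/-- Pigeonhole: the first `b` letters have to go to the `r - a` places after the first `a`. -/
lemma dist₀Of_eq_empty {a b : ℕ} (P Q : Set ℕ) (ha : a ≤ r) (hb : b ≤ r) (hab : r < a + b) :
    dist₀Of (r := r) a P b Q = ∅ := by
  refine Set.eq_empty_of_forall_notMem fun d hd => ?_
  have h1 : ((Finset.univ.filter fun j : Fin r => j.val < b).image d.right) ⊆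
      Finset.univ.filter fun j : Fin r => ¬ j.val < a := by
    intro x hx
    obtain ⟨j, hj, rfl⟩ := Finset.mem_image.1 hx
    have := not_common_letter hd (Finset.mem_filter.1 hj).2
    exact Finset.mem_filter.2 ⟨Finset.mem_univ _, by omega⟩
  have h2 := Finset.card_le_card h1
  rw [Finset.card_image_of_injective _ d.right.injective] at h2
  have h3 : ∀ n ≤ r, (Finset.univ.filter fun j : Fin r => j.val < n).card = n := fun n hn => by
    rw [Fin.card_filter_val_lt, min_eq_right hn]
  have h4 := Finset.card_filter_add_card_filter_not (s := (Finset.univ : Finset (Fin r)))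
    (fun j => j.val < a)
  rw [h3 a ha, Finset.card_univ, Fintype.card_fin] at h4
  rw [h3 b hb] at h2
  omega

end Specialization

namespace Bicomposition

variable {n r : ℕ} (lam : Bicomposition n r)

lemma size₁_le : lam.size₁ ≤ r := by
  have := lam.sum_eq
  unfold size₁
  omega

lemma size₁_mem_partialSums : lam.size₁ ∈ lam.partialSums := by
  refine ⟨max n r, ?_⟩
  have h : ∀ i : Fin n, ¬ (Fin.natAdd (max n r) i).val < max n r := fun i => by
    rw [Fin.val_natAdd]; omega
  have h' : ∀ i : Fin (max n r), (Fin.castAdd n i).val < max n r := fun i => i.isLt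
  rw [Finset.sum_filter, Fin.sum_univ_add]
  simp only [h, h', if_true, if_false, Finset.sum_const_zero, add_zero, bar, Fin.append_left, size₁]

variable {R : Type*} [CommRing R] (q₀ q : Rˣ)

lemma x_eq : lam.x q₀ q = (EigenData.index q₀ q).elem r lam.size₁ lam.partialSums := by
  rw [x, EigenData.elem, piPlus_eq, EigenData.youngSum]
  congr 1
  refine Finset.sum_congr rfl fun w _ => ?_
  simp [EigenData.index]

lemma y_eq : lam.y q₀ q = (EigenData.sign q₀ q).elem r lam.size₁ lam.partialSums := by
  rw [y, EigenData.elem, piMinus_eq, EigenData.youngSum]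
  congr 1

end Bicomposition

end HeckeB
end

theorem theorem4p3 {R : Type*} [CommRing R] (n r : ℕ) (q₀ q : Rˣ)
    (hq₀ : (q₀ : R) + 1 ∈ nonZeroDivisors R) :
    (∀ a b : ℕ, a ≤ r → b ≤ r →
      HeckeB.rightIdeal R (HeckeB.piPlus (r := r) q₀ q a) ⊓
          HeckeB.leftIdeal R (HeckeB.piMinus (r := r) q₀ q b) =
        HeckeB.sandwich R (HeckeB.piPlus (r := r) q₀ q a) (HeckeB.piMinus (r := r) q₀ q b) ∧
      (r < a + b →
        HeckeB.sandwich R (HeckeB.piPlus (r := r) q₀ q a)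
          (HeckeB.piMinus (r := r) q₀ q b) = ⊥)) ∧
    ((q : R) + 1 ∈ nonZeroDivisors R → ∀ lam mu : HeckeB.Bicomposition n r,
      (HeckeB.rightIdeal R (lam.x q₀ q) ⊓ HeckeB.leftIdeal R (mu.y q₀ q) =
          HeckeB.sandwich R (lam.x q₀ q) (mu.y q₀ q) ∧
        LinearIndependent R (fun w : lam.dist₀ mu =>
          lam.x q₀ q * HeckeB.T q₀ q w.1 * mu.y q₀ q) ∧
        Submodule.span R (Set.range (fun w : lam.dist₀ mu =>
          lam.x q₀ q * HeckeB.T q₀ q w.1 * mu.y q₀ q)) =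
          HeckeB.sandwich R (lam.x q₀ q) (mu.y q₀ q)) ∧
      (HeckeB.rightIdeal R (lam.y q₀ q) ⊓ HeckeB.leftIdeal R (mu.x q₀ q) =
          HeckeB.sandwich R (lam.y q₀ q) (mu.x q₀ q) ∧
        LinearIndependent R (fun w : lam.dist₀ mu =>
          lam.y q₀ q * HeckeB.T q₀ q w.1 * mu.x q₀ q) ∧
        Submodule.span R (Set.range (fun w : lam.dist₀ mu =>
          lam.y q₀ q * HeckeB.T q₀ q w.1 * mu.x q₀ q)) =
          HeckeB.sandwich R (lam.y q₀ q) (mu.x q₀ q))) := by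
  have h₀ : (HeckeB.EigenData.index q₀ q).κ₀ - (HeckeB.EigenData.sign q₀ q).κ₀ ∈
      nonZeroDivisors R := by
    simpa [HeckeB.EigenData.index, HeckeB.EigenData.sign] using hq₀
  have hneg : ∀ {c : R}, c + 1 ∈ nonZeroDivisors R → -1 - c ∈ nonZeroDivisors R := by
    intro c hc
    have h : -1 - c = -1 * (c + 1) := by ring
    rw [h]
    exact mul_mem (isUnit_one.neg.mem_nonZeroDivisors) hc
  constructor
  · intro a b ha hb
    -- When every place is a separator the Young subgroups are trivial; no common simple reflection
    -- can occur, so nothing is required of `q + 1`.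
    have h := (HeckeB.EigenData.index q₀ q).intersection_eq (HeckeB.EigenData.sign q₀ q)
      (Set.mem_univ a) ha (Set.mem_univ b) hb h₀ (Or.inr rfl)
    rw [HeckeB.elem_univ, HeckeB.elem_univ, ← HeckeB.piPlus_eq, ← HeckeB.piMinus_eq] at h
    refine ⟨h.1, fun hab => ?_⟩
    rw [← h.2.2, Submodule.span_eq_bot]
    rintro _ ⟨⟨w, hw⟩, rfl⟩
    rw [HeckeB.dist₀Of_eq_empty _ _ ha hb hab] at hw
    exact absurd hw (Set.notMem_empty _)
  · intro hq lam mu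
    simp only [HeckeB.Bicomposition.x_eq, HeckeB.Bicomposition.y_eq]
    -- Both statements are the same theorem with the two sets of data interchanged; the eigenvalue
    -- differences only change sign.
    refine ⟨(HeckeB.EigenData.index q₀ q).intersection_eq (HeckeB.EigenData.sign q₀ q)
      lam.size₁_mem_partialSums lam.size₁_le mu.size₁_mem_partialSums mu.size₁_le h₀ (Or.inl ?_),
      (HeckeB.EigenData.sign q₀ q).intersection_eq (HeckeB.EigenData.index q₀ q)
      lam.size₁_mem_partialSums lam.size₁_le mu.size₁_mem_partialSums mu.size₁_le (hneg hq₀)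
      (Or.inl (hneg hq))⟩
    simpa [HeckeB.EigenData.index, HeckeB.EigenData.sign] using hq
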